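/- Let $N\ge 2$ and $\alpha\in(0,1)$. For $k>1$ let $R_k=(-1,1)^{N-1}\times(-k,k)$ and $\Omega_k=R_k\setminus\overline{B_\alpha}$, where $B_r\subset\mathbb R^N$ is the open ball of radius $r$ centered at the origin. Write $|\cdot|$ for Lebesgue measure of domains and for $(N-1)$-dimensional Hausdorff measure $\sigma$ of boundaries, and let the quermassintegrals $W_i(E)$ of a bounded convex domain $E$ be defined by $|\{x:\operatorname{dist}(x,E)<\delta\}|=\sum_{i=0}^N\binom Ni W_i(E)\,\delta^i$ for $\delta>0$. For $\Omega=\Omega_{\rm out}\setminus\overline{\Omega_{\rm in}}$ and $h_{\rm in},h_{\rm out}\in[0,+\infty]$ let $$\lambda_1(\Omega;h_{\rm in},h_{\rm out})=\inf_{v}\frac{\int_\Omega|\nabla v|^2\,dx+h_{\rm in}\int_{\partial\Omega_{\rm in}}v^2\,d\sigma+h_{\rm out}\int_{\partial\Omega_{\rm out}}v^2\,d\sigma}{\int_\Omega v^2\,dx}$$ be the first eigenvalue of the Robin Laplacian, the infimum being over all nonzero $v\in H^1(\Omega)$; a parameter equal to $+\infty$ stands for the Dirichlet condition, that is, $v$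 is required to have zero trace on the corresponding part of the boundary and the corresponding boundary term is omitted. Then: 1. For every $k>1$ there is exactly one $\beta_k>0$ with $|\partial B_{\beta_k}|=|\partial R_k|$. 2. For every $k>1$ we have $\alpha<\beta_k$, the sets $\Omega_{\rm in}=B_\alpha$ and $\Omega_{\rm out}=R_k$ are convex with $\overline{\Omega_{\rm in}}\subset\Omega_{\rm out}$, and $\Omega_k$ satisfies the quermassintegral constraint $W_{N-1}(B_\alpha)=W_{N-1}(\Omega_{\rm in})$ and the perimeter constraint $|\partial B_{\beta_k}|=|\partial\Omega_{\rm out}|$, but $$|\Omega_k|<|B_{\beta_k}\setminus\overline{B_\alpha}|.$$ 3. There are $K>1$ and $H\in[0,\infty)$ such that for all $k\ge K$ the Hersch--Weinberger inequality $\lambda_1(\Omega_{\rm out}\setminus\overline{\Omega_{\rm in}})\le\lambda_1(B_{\beta_k}\setminus\overline{B_\alpha})$ is reversed for $\Omega_k$: for the Dirichlet eigenvalues, $$\lambda_1(\Omega_k;+\infty,+\infty)>\lambda_1(B_{\beta_k}\setminus\overline{B_\alpha};+\infty,+\infty),$$ and likewise $$\lambda_1(\Omega_k;h_{\rm in},h_{\rm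 out})>\lambda_1(B_{\beta_k}\setminus\overline{B_\alpha};h_{\rm in},h_{\rm out})\qquad\text{for all }h_{\rm in},h_{\rm out}\in[H,+\infty].$$ -/

import Mathlib

open MeasureTheory Set Filter Topology
open scoped ENNReal NNReal ContDiff Gradient

noncomputable section

namespace HerschWeinberger

/-- The space `ℝ^N` with its Euclidean norm. -/
abbrev Euc (N : ℕ) : Type := EuclideanSpace ℝ (Fin N)

/-- The surface measure: the `(N-1)`-dimensional Hausdorff measure on `ℝ^N`, with the usual
normalization (in dimension `d` it agrees with the Lebesgue measure of `ℝ^d`). -/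
def surf (N : ℕ) : Measure (Euc N) := μHE[N - 1]

/-- `|∂E|`, the `(N-1)`-dimensional Hausdorff measure of the topological boundary of `E`. -/
def perimeter {N : ℕ} (E : Set (Euc N)) : ℝ≥0∞ := surf N (frontier E)

/-! ### Quermassintegrals -/

/-- `p` is the Steiner polynomial of `E`: it has degree at most `N`, and `p(δ)` is the volume of
the `δ`-neighbourhood of `E` for every `δ > 0`. -/
def IsSteinerPolynomial {N : ℕ} (E : Set (Euc N)) (p : Polynomial ℝ) : Prop :=
  p.natDegree ≤ N ∧ ∀ δ : ℝ, 0 < δ → volume.real (Metric.thickening δ E) = p.eval δ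

open scoped Classical in
/-- The quermassintegral `W_i(E)`, defined through
`|E_δ| = ∑_{i=0}^N (N choose i) W_i(E) δ^i` for `δ > 0`
(and `0` if the volume of `E_δ` is not a polynomial in `δ`). -/
def quermassintegral {N : ℕ} (i : ℕ) (E : Set (Euc N)) : ℝ :=
  if h : ∃ p : Polynomial ℝ, IsSteinerPolynomial E p then h.choose.coeff i / (N.choose i : ℝ)
  else 0

/-! ### Sobolev functions and their traces -/

/-- `g` is the weak gradient of `v` in the open set `Ω`. -/
def IsWeakGradient {N : ℕ} (Ω : Set (Euc N)) (v : Euc N → ℝ) (g : Euc N → Euc N) : Prop :=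
  ∀ φ : Euc N → ℝ, ContDiff ℝ ∞ φ → HasCompactSupport φ → tsupport φ ⊆ Ω →
    ∀ e : Euc N, ∫ x in Ω, v x * fderiv ℝ φ x e = -∫ x in Ω, inner ℝ (g x) e * φ x

/-- `v ∈ H¹(Ω)`, with weak gradient `g`. -/
structure MemH1 {N : ℕ} (Ω : Set (Euc N)) (v : Euc N → ℝ) (g : Euc N → Euc N) : Prop where
  memLp : MemLp v 2 (volume.restrict Ω)
  memLp_grad : MemLp g 2 (volume.restrict Ω)
  weakGradient : IsWeakGradient Ω v g

/-- `T ∈ L²(∂Ω)` is the trace on `∂Ω` of the function `v ∈ H¹(Ω)` with weak gradient `g`: there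
are smooth functions on `ℝ^N` which converge to `v` in `H¹(Ω)` and whose restrictions to `∂Ω`
converge to `T` in `L²(∂Ω)`. (On a bounded Lipschitz domain every `v ∈ H¹(Ω)` has exactly
one trace.) -/
structure IsTrace {N : ℕ} (Ω : Set (Euc N)) (v : Euc N → ℝ) (g : Euc N → Euc N)
    (T : Euc N → ℝ) : Prop where
  memLp : MemLp T 2 ((surf N).restrict (frontier Ω))
  approx : ∃ φ : ℕ → Euc N → ℝ, (∀ n, ContDiff ℝ ∞ (φ n)) ∧
    Tendsto (fun n ↦ eLpNorm (fun x ↦ φ n x - v x) 2 (volume.restrict Ω)) atTop (𝓝 0) ∧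
    Tendsto (fun n ↦ eLpNorm (fun x ↦ ∇ (φ n) x - g x) 2 (volume.restrict Ω)) atTop (𝓝 0) ∧
    Tendsto (fun n ↦ eLpNorm (fun x ↦ φ n x - T x) 2 ((surf N).restrict (frontier Ω)))
      atTop (𝓝 0)

/-! ### The first eigenvalue -/

/-- The domain `Ω = Ω_out \ cl(Ω_in)`. -/
def annular {N : ℕ} (Ωin Ωout : Set (Euc N)) : Set (Euc N) := Ωout \ closure Ωin

/-- The Robin energy
`∫_Ω |∇v|² + h_in ∫_{∂Ω_in} v² dσ + h_out ∫_{∂Ω_out} v² dσ`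
of a function with weak gradient `g` and trace `T`. A boundary term whose parameter is `+∞` is
omitted, since `(⊤ : ℝ≥0∞).toReal = 0`. -/
def robinEnergy {N : ℕ} (Ωin Ωout : Set (Euc N)) (hin hout : ℝ≥0∞)
    (g : Euc N → Euc N) (T : Euc N → ℝ) : ℝ :=
  (∫ x in annular Ωin Ωout, ‖g x‖ ^ 2)
    + hin.toReal * (∫ x in frontier Ωin, T x ^ 2 ∂(surf N))
    + hout.toReal * (∫ x in frontier Ωout, T x ^ 2 ∂(surf N))

/-- The first eigenvalue `λ₁(Ω)` of the Laplacian in `Ω = Ω_out \ cl(Ω_in)` with Robin parameter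
`h_in ∈ [0,+∞]` on `∂Ω_in` and `h_out ∈ [0,+∞]` on `∂Ω_out`, where `+∞` stands for the zero
Dirichlet condition: the infimum of the Rayleigh quotient over the nonzero functions of `H¹(Ω)`
whose trace vanishes on the parts of the boundary with an infinite parameter. -/
def firstEigenvalue {N : ℕ} (Ωin Ωout : Set (Euc N)) (hin hout : ℝ≥0∞) : ℝ :=
  sInf {q : ℝ | ∃ (v : Euc N → ℝ) (g : Euc N → Euc N) (T : Euc N → ℝ),
    MemH1 (annular Ωin Ωout) v g ∧ IsTrace (annular Ωin Ωout) v g T ∧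
    ¬ (v =ᵐ[volume.restrict (annular Ωin Ωout)] 0) ∧
    (hin = ⊤ → T =ᵐ[(surf N).restrict (frontier Ωin)] 0) ∧
    (hout = ⊤ → T =ᵐ[(surf N).restrict (frontier Ωout)] 0) ∧
    q = robinEnergy Ωin Ωout hin hout g T / ∫ x in annular Ωin Ωout, v x ^ 2}

/-! ### The domains -/

/-- The open ball `B_r` centered at the origin. -/
def originBall (N : ℕ) (r : ℝ) : Set (Euc N) := Metric.ball 0 r

/-- The parallelepiped `R_k = (-1,1)^{N-1} × (-k,k)` (the last coordinate ranges over
`(-k,k)`). -/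
def box (N : ℕ) (k : ℝ) : Set (Euc N) :=
  {x | ∀ i : Fin N, x i ∈ if (i : ℕ) + 1 = N then Ioo (-k) k else Ioo (-1 : ℝ) 1}

/-- The convexity, quermassintegral and perimeter constraints relating `Ω_out \ cl(Ω_in)` to the
concentric spherical shell `B_β \ cl(B_α)`, `0 < α < β`. -/
structure ShellConstraints {N : ℕ} (α β : ℝ) (Ωin Ωout : Set (Euc N)) : Prop where
  pos : 0 < α
  lt : α < β
  closure_subset : closure Ωin ⊆ Ωout
  convex_in : Convex ℝ Ωin
  convex_out : Convex ℝ Ωout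
  quermass_eq : quermassintegral (N - 1) (originBall N α) = quermassintegral (N - 1) Ωin
  perimeter_eq : perimeter (originBall N β) = perimeter Ωout

end HerschWeinberger

end

/-!
The eigenvalue inequality is reversed because `λ₁` of the shell tends to `0` while `λ₁` of the box
minus the ball stays away from `0`.

*The radii.* The perimeter of `B_r` is `r ^ (N - 1)` times that of the unit ball, so `β_k` exists
and is unique once the unit sphere is known to have positive finite measure (`surf_sphere_pos`,
`surf_sphere_le`). What follows needs the explicit upper bound
`|∂B_1| ≤ N |B_1|`. It is proved by comparison with the cone measure of the sphere: on a small cap,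
the inverse of the gnomonic projection from the tangent hyperplane has Lipschitz constant `1`, hence
the measure of a part `A` of the cap is at most that of its projection, which up to a factor close
to `1` is `N` times the volume of the cone over `A`
(`surf_le_coneMeasure_of_le_apply_zero`). Compactness extends this to the whole sphere.

*The volumes.* A box with half-lengths `L i` has perimeter at least `|R| ∑ i, 1 / L i`, the sum of
the measures of its open faces (`le_perimeter_openBox`). With the bound on the sphere and
Bernoulli's inequality this gives the isoperimetric inequality `|R_k| < |B_{β_k}|`
(`volume_box_lt_of_perimeter_eq`). Since the unit ball lies in a cube of side `2`, it also
gives `k < β_k ^ N`; in particular `β_k > 1 > α`, and `β_k` tends to infinity.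

*The shell.* As `β_k` tends to infinity the shell contains arbitrarily large balls, and dilated
bumps with zero trace, admissible for every boundary condition, have arbitrarily small Rayleigh
quotient (`exists_firstEigenvalue_lt`).

*The box.* As `N ≥ 2`, the first coordinate ranges over `(-1, 1)`. From each point of the box
outside the ball, a segment in the first coordinate direction and of length at most `1` leads away
from the ball to one of the faces `x 0 = ± 1`. Integrating the derivative along these segments gives
a Poincaré inequality `∫ v² ≤ 8 ∫_{∂R_k} v² + 4 ∫ |∇v|²` with constants independent of `k`, for
smooth functions (`lintegral_sq_le_of_contDiff`) and by approximation for all functions of `H¹` with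
a trace (`integral_sq_le_of_isTrace`). Hence
`λ₁ ≥ 1 / 8` as soon as the outer parameter is at least `1`, whatever the inner one is
(`le_firstEigenvalue_openBox`).
-/

noncomputable section

namespace HerschWeinberger

/-! ### Coordinate hyperplanes and maps of Lipschitz constant one -/

/-- The affine embedding of `ℝ^n` into `ℝ^(n+1)` as the hyperplane `{x | x i = c}`. -/
def slice {n : ℕ} (i : Fin (n + 1)) (c : ℝ) (y : Euc n) : Euc (n + 1) :=
  WithLp.toLp 2 (i.insertNth c y.ofLp)

@[simp] lemma slice_apply_same {n : ℕ} (i : Fin (n + 1)) (c : ℝ) (y : Euc n) :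
    slice i c y i = c := by simp [slice]

@[simp] lemma slice_apply_succAbove {n : ℕ} (i : Fin (n + 1)) (c : ℝ) (y : Euc n) (j : Fin n) :
    slice i c y (i.succAbove j) = y j := by simp [slice]

lemma exists_slice_eq {n : ℕ} (i : Fin (n + 1)) (x : Euc (n + 1)) :
    ∃ y : Euc n, slice i (x i) y = x :=
  ⟨WithLp.toLp 2 (i.removeNth x.ofLp), by simp [slice]⟩

lemma norm_slice_sq {n : ℕ} (i : Fin (n + 1)) (c : ℝ) (y : Euc n) :
    ‖slice i c y‖ ^ 2 = c ^ 2 + ‖y‖ ^ 2 := by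
  simp [EuclideanSpace.norm_sq_eq, Fin.sum_univ_succAbove _ i]

lemma slice_sub_slice {n : ℕ} (i : Fin (n + 1)) (c d : ℝ) (y z : Euc n) :
    slice i c y - slice i d z = slice i (c - d) (y - z) := by
  ext j
  refine Fin.succAboveCases i ?_ (fun k ↦ ?_) j <;> simp

lemma smul_slice {n : ℕ} (i : Fin (n + 1)) (t c : ℝ) (y : Euc n) :
    t • slice i c y = slice i (t * c) (t • y) := by
  ext j
  refine Fin.succAboveCases i ?_ (fun k ↦ ?_) j <;> simp

lemma isometry_slice {n : ℕ} (i : Fin (n + 1)) (c : ℝ) : Isometry (slice i c) := by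
  refine Isometry.of_dist_eq fun y z ↦ ?_
  rw [dist_eq_norm, dist_eq_norm, slice_sub_slice, sub_self]
  have := norm_slice_sq i 0 (y - z)
  simp only [ne_eq, OfNat.ofNat_ne_zero, not_false_eq_true, zero_pow, zero_add] at this
  exact (sq_eq_sq₀ (norm_nonneg _) (norm_nonneg _)).1 this

/-- Fubini's theorem in the form used below: `ℝ^(n+1)` is the product of a coordinate axis and
the complementary hyperplane. -/
lemma measurePreserving_slice {n : ℕ} (i : Fin (n + 1)) :
    MeasurePreserving (fun p : ℝ × Euc n ↦ slice i p.1 p.2) := by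
  have h1 : MeasurePreserving (Prod.map id (@WithLp.ofLp 2 (Fin n → ℝ)))
      (volume : Measure (ℝ × Euc n)) (volume : Measure (ℝ × (Fin n → ℝ))) :=
    (MeasurePreserving.id _).prod (PiLp.volume_preserving_ofLp (Fin n))
  exact (PiLp.volume_preserving_toLp (Fin (n + 1))).comp
    ((volume_preserving_piFinSuccAbove (fun _ ↦ ℝ) i).symm.comp h1)

lemma continuous_slice {n : ℕ} (i : Fin (n + 1)) :
    Continuous (fun p : ℝ × Euc n ↦ slice i p.1 p.2) := by
  unfold slice
  fun_prop

lemma surf_image_slice {n : ℕ} (i : Fin (n + 1)) (c : ℝ) (s : Set (Euc n)) :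
    surf (n + 1) (slice i c '' s) = volume s := by
  rw [surf, (isometry_slice i c).euclideanHausdorffMeasure_image, Nat.add_sub_cancel,
    EuclideanSpace.euclideanHausdorffMeasure_eq_volume]

lemma map_slice_volume {n : ℕ} (i : Fin (n + 1)) (c : ℝ) :
    (volume : Measure (Euc n)).map (slice i c) = (surf (n + 1)).restrict (range (slice i c)) := by
  rw [surf, Nat.add_sub_cancel, ← (isometry_slice i c).map_euclideanHausdorffMeasure,
    EuclideanSpace.euclideanHausdorffMeasure_eq_volume]

/-- A map of Lipschitz constant `1` does not increase the surface measure. -/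
lemma surf_image_le {X : Type*} [MetricSpace X] [MeasurableSpace X] [BorelSpace X] {Y : Type*}
    [MetricSpace Y] [MeasurableSpace Y] [BorelSpace Y] {d : ℕ}
    {f : X → Y} {s : Set X} (hf : LipschitzOnWith 1 f s) :
    (μHE[d] : Measure Y) (f '' s) ≤ (μHE[d] : Measure X) s := by
  have := hf.hausdorffMeasure_image_le (d := d) (by positivity)
  simp only [Measure.euclideanHausdorffMeasure, Measure.smul_apply]
  gcongr
  simpa using this

/-- Outside of the open unit ball the radial projection to the unit sphere has Lipschitz
constant `1`. -/
lemma norm_normalize_sub_le {E : Type*} [NormedAddCommGroup E] [InnerProductSpace ℝ E] {x y : E}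
    (hx : 1 ≤ ‖x‖) (hy : 1 ≤ ‖y‖) : ‖‖x‖⁻¹ • x - ‖y‖⁻¹ • y‖ ≤ ‖x - y‖ := by
  have hx0 : 0 < ‖x‖ := by linarith
  have hy0 : 0 < ‖y‖ := by linarith
  refine (sq_le_sq₀ (norm_nonneg _) (norm_nonneg _)).1 ?_
  rw [norm_sub_sq_real, norm_sub_sq_real, norm_smul, norm_smul, inner_smul_left, inner_smul_right]
  simp only [norm_inv, norm_norm, inv_mul_cancel₀ hx0.ne', inv_mul_cancel₀ hy0.ne']
  have hc := real_inner_le_norm x y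
  set c := ‖x‖⁻¹ * (‖y‖⁻¹ * inner ℝ x y) with hcdef
  have h1 : inner ℝ x y = ‖x‖ * ‖y‖ * c := by rw [hcdef]; field_simp
  have h2 : c ≤ 1 := by
    rw [h1] at hc
    by_contra! h
    nlinarith [mul_pos hx0 hy0]
  simp only [conj_trivial]
  rw [← hcdef, h1]
  nlinarith [sq_nonneg (‖x‖ - ‖y‖), mul_nonneg (sub_nonneg.2 h2)
    (sub_nonneg.2 (one_le_mul_of_one_le_of_one_le hx hy))]

/-! ### The surface measure of the unit sphere -/

/-- The cone measure of the unit sphere, as a measure on `ℝ^n`: the measure of a subset `A` of the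
sphere is the volume of the part of the open
unit ball that lies on the rays through `A`. -/
def coneMeasure (n : ℕ) : Measure (Euc n) :=
  (volume.restrict (Metric.ball 0 1)).map (fun x ↦ ‖x‖⁻¹ • x)

lemma measurable_normalize (n : ℕ) : Measurable (fun x : Euc n ↦ ‖x‖⁻¹ • x) := by
  fun_prop

lemma coneMeasure_apply {n : ℕ} {A : Set (Euc n)} (hA : MeasurableSet A) :
    coneMeasure n A = volume {x : Euc n | ‖x‖ < 1 ∧ ‖x‖⁻¹ • x ∈ A} := by
  rw [coneMeasure, Measure.map_apply (measurable_normalize n) hA,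
    Measure.restrict_apply (measurable_normalize n hA)]
  congr 1
  ext x
  simp [and_comm]

lemma lintegral_Ioo_pow (n : ℕ) {c : ℝ} (hc : 0 < c) :
    ∫⁻ t in Ioo 0 c, ENNReal.ofReal (t ^ n) = ENNReal.ofReal (c ^ (n + 1) / (n + 1)) := by
  rw [← ofReal_integral_eq_lintegral_ofReal]
  · rw [← integral_Ioc_eq_integral_Ioo, ← intervalIntegral.integral_of_le hc.le, integral_pow]
    simp
  · exact (((continuous_pow n).integrableOn_Icc (a := 0) (b := c))).mono_set Ioo_subset_Icc_self
  · filter_upwards [self_mem_ae_restrict measurableSet_Ioo] with t ht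
    exact pow_nonneg ht.1.le _

/-- The volume of the truncated cone `{(t, y) | 0 < t < c, y ∈ t G}`. -/
lemma volume_cone {n : ℕ} {G : Set (Euc n)} (hG : MeasurableSet G) {c : ℝ} (hc : 0 < c) :
    ENNReal.ofReal (c ^ (n + 1) / (n + 1)) * volume G ≤
      volume {p : ℝ × Euc n | p.1 ∈ Ioo 0 c ∧ p.1⁻¹ • p.2 ∈ G} := by
  have hm : MeasurableSet {p : ℝ × Euc n | p.1 ∈ Ioo 0 c ∧ p.1⁻¹ • p.2 ∈ G} :=
    (measurable_fst measurableSet_Ioo).inter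
      ((measurable_fst.inv.smul measurable_snd) hG)
  rw [Measure.volume_eq_prod, Measure.prod_apply hm, ← lintegral_Ioo_pow n hc,
    ← lintegral_mul_const _ (by fun_prop)]
  refine le_trans ?_ (setLIntegral_le_lintegral (Ioo 0 c) _)
  refine setLIntegral_mono' measurableSet_Ioo fun t ht ↦ ?_
  have : Prod.mk t ⁻¹' {p : ℝ × Euc n | p.1 ∈ Ioo 0 c ∧ p.1⁻¹ • p.2 ∈ G}
      = (fun y : Euc n ↦ t⁻¹ • y) ⁻¹' G := by
    ext y; simp [ht.1, ht.2]
  rw [this, Measure.addHaar_preimage_smul _ (inv_ne_zero ht.1.ne')]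
  simp [abs_of_pos ht.1]

/-- On the part `{a 0 ≥ c}` of the unit sphere, the gnomonic projection from the center to the
tangent hyperplane `{x 0 = 1}` bounds the surface measure by the cone measure: the inverse of
the projection has Lipschitz constant `1`, and the truncated cone over the image lies in the
ball. -/
lemma surf_le_coneMeasure_of_le_apply_zero {n : ℕ} {c : ℝ} (hc : 0 < c) {A : Set (Euc (n + 1))}
    (hA : MeasurableSet A) (hA1 : ∀ a ∈ A, ‖a‖ = 1) (hAc : ∀ a ∈ A, c ≤ a 0) :
    ENNReal.ofReal (c ^ (n + 1) / (n + 1)) * surf (n + 1) A ≤ coneMeasure (n + 1) A := by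
  set f : Euc (n + 1) → Euc (n + 1) := fun x ↦ ‖x‖⁻¹ • x with hf
  -- `G` is the gnomonic projection of `A`.
  set G : Set (Euc n) := (fun z ↦ f (slice 0 1 z)) ⁻¹' A with hG
  have hGm : MeasurableSet G :=
    ((measurable_normalize _).comp (isometry_slice 0 1).continuous.measurable) hA
  have hlip : LipschitzOnWith 1 f {x | 1 ≤ ‖x‖} :=
    LipschitzOnWith.of_dist_le_mul fun x hx y hy ↦ by
      simpa [dist_eq_norm] using norm_normalize_sub_le hx hy
  have hnorm : ∀ z : Euc n, 1 ≤ ‖slice 0 1 z‖ := fun z ↦ by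
    have := norm_slice_sq 0 1 z
    nlinarith [norm_nonneg (slice 0 1 z), sq_nonneg ‖z‖]
  have h1 : surf (n + 1) A ≤ volume G := by
    have hsub : A ⊆ f '' (slice 0 1 '' G) := by
      intro a ha
      have ha0 : 0 < a 0 := hc.trans_le (hAc a ha)
      obtain ⟨y, hy⟩ := exists_slice_eq 0 a
      have hs : slice 0 1 ((a 0)⁻¹ • y) = (a 0)⁻¹ • a := by
        have h := smul_slice 0 (a 0)⁻¹ (a 0) y
        rw [hy, inv_mul_cancel₀ ha0.ne'] at h
        exact h.symm
      have hfa : f (slice 0 1 ((a 0)⁻¹ • y)) = a := by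
        rw [hs, hf]
        simp [norm_smul, hA1 a ha, abs_of_pos ha0, smul_smul, ha0.ne']
      exact ⟨_, ⟨(a 0)⁻¹ • y, by simpa [hG, hfa] using ha, rfl⟩, hfa⟩
    refine (measure_mono hsub).trans ?_
    rw [← surf_image_slice 0 1 G]
    refine surf_image_le (hlip.mono ?_)
    rintro _ ⟨z, -, rfl⟩
    exact hnorm z
  refine le_trans (by gcongr) ((volume_cone hGm hc).trans ?_)
  rw [coneMeasure_apply hA]
  have hCm : MeasurableSet {x : Euc (n + 1) | ‖x‖ < 1 ∧ ‖x‖⁻¹ • x ∈ A} :=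
    (measurableSet_lt measurable_norm measurable_const).inter (measurable_normalize _ hA)
  rw [← (measurePreserving_slice (n := n) 0).measure_preimage hCm.nullMeasurableSet]
  refine measure_mono ?_
  rintro ⟨t, y⟩ ⟨⟨ht0, htc⟩, hy⟩
  simp only at ht0 htc hy
  have hs : slice 0 t y = t • slice 0 1 (t⁻¹ • y) := by
    rw [smul_slice, smul_smul, mul_inv_cancel₀ ht0.ne', one_smul, mul_one]
  have hp := hnorm (t⁻¹ • y)
  have hp0 : 0 < ‖slice 0 1 (t⁻¹ • y)‖ := by linarith
  have hc' : c ≤ ‖slice 0 1 (t⁻¹ • y)‖⁻¹ := by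
    have := hAc _ hy
    simpa [hf] using this
  constructor
  · simp only
    rw [hs, norm_smul, Real.norm_of_nonneg ht0.le]
    calc t * ‖slice 0 1 (t⁻¹ • y)‖ < ‖slice 0 1 (t⁻¹ • y)‖⁻¹ * ‖slice 0 1 (t⁻¹ • y)‖ := by
          gcongr; linarith
      _ = 1 := inv_mul_cancel₀ hp0.ne'
  · have : ‖slice 0 t y‖⁻¹ • slice 0 t y = f (slice 0 1 (t⁻¹ • y)) := by
      rw [hs, norm_smul, Real.norm_of_nonneg ht0.le, smul_smul, mul_inv, mul_right_comm,
        inv_mul_cancel₀ ht0.ne', one_mul]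
    change ‖slice 0 t y‖⁻¹ • slice 0 t y ∈ A
    rw [this]
    exact hy

lemma surf_image_isometryEquiv {n : ℕ} (L : Euc n ≃ₗᵢ[ℝ] Euc n) (A : Set (Euc n)) :
    surf n (L '' A) = surf n A :=
  L.isometry.euclideanHausdorffMeasure_image A

lemma coneMeasure_image_isometryEquiv {n : ℕ} (L : Euc n ≃ₗᵢ[ℝ] Euc n) {A : Set (Euc n)}
    (hA : MeasurableSet A) : coneMeasure n (L '' A) = coneMeasure n A := by
  have hLA : MeasurableSet (L '' A) := L.toHomeomorph.measurableEmbedding.measurableSet_image.2 hA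
  rw [coneMeasure_apply hA, coneMeasure_apply hLA,
    ← L.measurePreserving.measure_preimage_emb L.toHomeomorph.measurableEmbedding]
  congr 1
  ext x
  simp [← map_smul]

/-- The cap estimate around an arbitrary pole `p`, by rotating `p` to the first basis vector. -/
lemma surf_le_coneMeasure_of_le_inner {n : ℕ} {c : ℝ} (hc : 0 < c) {p : Euc (n + 1)}
    (hp : ‖p‖ = 1) {A : Set (Euc (n + 1))} (hA : MeasurableSet A) (hA1 : ∀ a ∈ A, ‖a‖ = 1)
    (hAc : ∀ a ∈ A, c ≤ inner ℝ p a) :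
    ENNReal.ofReal (c ^ (n + 1) / (n + 1)) * surf (n + 1) A ≤ coneMeasure (n + 1) A := by
  set e : Euc (n + 1) := EuclideanSpace.single 0 1 with he
  obtain ⟨L, hL⟩ : ∃ L : Euc (n + 1) ≃ₗᵢ[ℝ] Euc (n + 1), L p = e :=
    ⟨_, Submodule.reflection_sub (by simp [hp, he])⟩
  rw [← surf_image_isometryEquiv L A, ← coneMeasure_image_isometryEquiv L hA]
  refine surf_le_coneMeasure_of_le_apply_zero hc
    (L.toHomeomorph.measurableEmbedding.measurableSet_image.2 hA) ?_ ?_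
  · rintro _ ⟨a, ha, rfl⟩
    simpa using hA1 a ha
  · rintro _ ⟨a, ha, rfl⟩
    have h := hAc a ha
    rw [← L.inner_map_map, hL, he, EuclideanSpace.inner_single_left] at h
    simpa using h

lemma ofReal_pow_mul_surf_sphere_le (n : ℕ) {c : ℝ} (hc : 0 < c) (hc1 : c < 1) :
    ENNReal.ofReal (c ^ (n + 1) / (n + 1)) * surf (n + 1) (Metric.sphere 0 1) ≤
      volume (Metric.ball (0 : Euc (n + 1)) 1) := by
  set S : Set (Euc (n + 1)) := Metric.sphere 0 1 with hS
  set C := ENNReal.ofReal (c ^ (n + 1) / (n + 1)) with hC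
  -- The estimate passes from small caps to the whole sphere by compactness.
  have key : ∃ t, S ⊆ t ∧ MeasurableSet t ∧ ∀ A, MeasurableSet A → A ⊆ S → A ⊆ t →
      C * surf (n + 1) A ≤ coneMeasure (n + 1) A := by
    refine (isCompact_sphere (0 : Euc (n + 1)) 1).induction_on
      (p := fun s ↦ ∃ t, s ⊆ t ∧ MeasurableSet t ∧ ∀ A, MeasurableSet A → A ⊆ S → A ⊆ t →
        C * surf (n + 1) A ≤ coneMeasure (n + 1) A) ?_ ?_ ?_ ?_
    · refine ⟨∅, Subset.rfl, .empty, fun A _ _ hA ↦ ?_⟩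
      simp [subset_empty_iff.1 hA]
    · rintro s s' hs ⟨t, ht, h⟩
      exact ⟨t, hs.trans ht, h⟩
    · rintro s s' ⟨t, ht, htm, h⟩ ⟨t', ht', htm', h'⟩
      refine ⟨t ∪ t', union_subset_union ht ht', htm.union htm', fun A hA hAS hAt ↦ ?_⟩
      rw [← measure_inter_add_sdiff A htm, ← measure_inter_add_sdiff (μ := coneMeasure _) A htm,
        mul_add]
      refine add_le_add (h _ (hA.inter htm) (inter_subset_left.trans hAS) inter_subset_right)
        (h' _ (hA.diff htm) (sdiff_subset.trans hAS) ?_)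
      rintro x ⟨hx, hxt⟩
      exact (hAt hx).resolve_left hxt
    · intro p hp
      have hp1 : ‖p‖ = 1 := by simpa [hS] using hp
      have hopen : IsOpen {a : Euc (n + 1) | c < inner ℝ p a} :=
        isOpen_lt continuous_const (by fun_prop)
      refine ⟨{a | c < inner ℝ p a}, mem_nhdsWithin_of_mem_nhds (hopen.mem_nhds ?_), _,
        Subset.rfl, hopen.measurableSet, fun A hA hAS hAt ↦
          surf_le_coneMeasure_of_le_inner hc hp1 hA (fun a ha ↦ by simpa [hS] using hAS ha)
            fun a ha ↦ (hAt ha).le⟩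
      simpa [real_inner_self_eq_norm_sq, hp1] using hc1
  obtain ⟨t, hSt, -, h⟩ := key
  refine (h S Metric.isClosed_sphere.measurableSet Subset.rfl hSt).trans ?_
  rw [coneMeasure_apply Metric.isClosed_sphere.measurableSet]
  exact measure_mono fun x hx ↦ by simpa using hx.1

/-- The surface measure of the unit sphere of `ℝ^(n+1)` is at most `n + 1` times the volume of the
unit ball. (Equality holds, but only this inequality matters.) -/
lemma surf_sphere_le (n : ℕ) : surf (n + 1) (Metric.sphere 0 1) ≤
    ENNReal.ofReal (n + 1) * volume (Metric.ball (0 : Euc (n + 1)) 1) := by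
  have hlim : Tendsto (fun c : ℝ ↦ ENNReal.ofReal (c ^ (n + 1) / (n + 1)) *
      surf (n + 1) (Metric.sphere 0 1)) (𝓝[<] 1)
      (𝓝 (ENNReal.ofReal (1 ^ (n + 1) / (n + 1)) * surf (n + 1) (Metric.sphere 0 1))) := by
    refine ENNReal.Tendsto.mul_const ?_ (Or.inl ?_)
    · refine (ENNReal.continuous_ofReal.tendsto _).comp (Tendsto.mono_left ?_ nhdsWithin_le_nhds)
      exact Continuous.tendsto (by fun_prop) _
    · simp; positivity
  have h := le_of_tendsto hlim (by
    filter_upwards [self_mem_nhdsWithin, mem_nhdsWithin_of_mem_nhds (lt_mem_nhds one_pos)]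
      with c hc hc0 using ofReal_pow_mul_surf_sphere_le n hc0 hc)
  calc surf (n + 1) (Metric.sphere 0 1)
      = ENNReal.ofReal (n + 1) * (ENNReal.ofReal (1 ^ (n + 1) / (n + 1)) *
          surf (n + 1) (Metric.sphere 0 1)) := by
        rw [← mul_assoc, ← ENNReal.ofReal_mul (by positivity), one_pow,
          mul_one_div_cancel (by positivity), ENNReal.ofReal_one, one_mul]
    _ ≤ _ := by gcongr

lemma surf_sphere_lt_top (n : ℕ) : surf (n + 1) (Metric.sphere 0 1) < ⊤ :=
  (surf_sphere_le n).trans_lt (ENNReal.mul_lt_top ENNReal.ofReal_lt_top measure_ball_lt_top)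

/-- The orthogonal projection of the sphere to a coordinate hyperplane covers the unit ball of the
hyperplane, so the sphere has positive surface measure. -/
lemma surf_sphere_pos (n : ℕ) : 0 < surf (n + 1) (Metric.sphere 0 1) := by
  set f : Euc (n + 1) → Euc n := fun x ↦ WithLp.toLp 2 (Fin.removeNth 0 x.ofLp) with hf
  have hfs : ∀ c y, f (slice 0 c y) = y := fun c y ↦ by ext j; simp [hf, slice]
  have hlip : LipschitzOnWith 1 f (Metric.sphere 0 1) := by
    refine LipschitzOnWith.of_dist_le_mul fun x _ y _ ↦ ?_
    obtain ⟨x', hx⟩ := exists_slice_eq 0 x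
    obtain ⟨y', hy⟩ := exists_slice_eq 0 y
    rw [← hx, ← hy, hfs, hfs, dist_eq_norm, dist_eq_norm, slice_sub_slice, NNReal.coe_one, one_mul]
    refine (sq_le_sq₀ (norm_nonneg _) (norm_nonneg _)).1 ?_
    rw [norm_slice_sq]
    nlinarith [sq_nonneg (x 0 - y 0)]
  have hsub : Metric.ball (0 : Euc n) 1 ⊆ f '' Metric.sphere 0 1 := by
    intro y hy
    have hy1 : ‖y‖ < 1 := by simpa using hy
    have h0 : 0 ≤ 1 - ‖y‖ ^ 2 := by nlinarith [norm_nonneg y]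
    refine ⟨slice 0 (√(1 - ‖y‖ ^ 2)) y, ?_, hfs _ _⟩
    have := norm_slice_sq 0 (√(1 - ‖y‖ ^ 2)) y
    rw [Real.sq_sqrt h0, sub_add_cancel] at this
    simpa using (pow_eq_one_iff_of_nonneg (norm_nonneg _) two_ne_zero).1 this
  have h1 : 0 < (volume : Measure (Euc n)) (Metric.ball 0 1) := Metric.measure_ball_pos _ _ one_pos
  refine h1.trans_le ((measure_mono hsub).trans ?_)
  rw [← EuclideanSpace.euclideanHausdorffMeasure_eq_volume]
  exact surf_image_le hlip

open scoped Pointwise in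
lemma perimeter_originBall {n : ℕ} {r : ℝ} (hr : 0 < r) :
    perimeter (originBall (n + 1) r) =
      ENNReal.ofReal (r ^ n) * surf (n + 1) (Metric.sphere 0 1) := by
  have h : frontier (originBall (n + 1) r) = r • Metric.sphere (0 : Euc (n + 1)) 1 := by
    rw [originBall, frontier_ball _ hr.ne', smul_sphere' hr.ne']
    simp [abs_of_pos hr]
  rw [perimeter, h, surf, Measure.euclideanHausdorffMeasure_smul₀ _ hr.ne', Nat.add_sub_cancel,
    ENNReal.smul_def, smul_eq_mul, ENNReal.coe_pow, ENNReal.ofReal_pow hr.le]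
  congr 2
  exact Real.enorm_eq_ofReal hr.le

/-! ### Volume and perimeter of boxes -/

/-- The open box centered at the origin with half-lengths `L i`. -/
def openBox {m : ℕ} (L : Fin m → ℝ) : Set (Euc m) := {x | ∀ i, x i ∈ Ioo (-L i) (L i)}

lemma openBox_eq_preimage {m : ℕ} (L : Fin m → ℝ) :
    openBox L = (EuclideanSpace.equiv (Fin m) ℝ).toHomeomorph ⁻¹'
      univ.pi fun i ↦ Ioo (-L i) (L i) := by
  ext x
  simp [openBox]

lemma isOpen_openBox {m : ℕ} (L : Fin m → ℝ) : IsOpen (openBox L) := by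
  rw [openBox_eq_preimage]
  exact (isOpen_set_pi finite_univ fun _ _ ↦ isOpen_Ioo).preimage (Homeomorph.continuous _)

lemma closure_openBox {m : ℕ} {L : Fin m → ℝ} (hL : ∀ i, 0 < L i) :
    closure (openBox L) = {x | ∀ i, x i ∈ Icc (-L i) (L i)} := by
  rw [openBox_eq_preimage, ← Homeomorph.preimage_closure, closure_pi_set]
  ext x
  simp only [mem_preimage, mem_univ_pi, mem_ofPred_eq]
  refine forall_congr' fun i ↦ ?_
  rw [closure_Ioo (by linarith [hL i])]
  rfl

lemma convex_openBox {m : ℕ} (L : Fin m → ℝ) : Convex ℝ (openBox L) := by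
  rw [openBox_eq_preimage]
  exact (convex_pi fun i _ ↦ convex_Ioo _ _).linear_preimage
    (EuclideanSpace.equiv (Fin m) ℝ).toLinearMap

lemma volume_openBox {m : ℕ} {L : Fin m → ℝ} (hL : ∀ i, 0 < L i) :
    volume (openBox L) = ENNReal.ofReal (∏ i, (2 * L i)) := by
  have : openBox L = WithLp.ofLp ⁻¹' univ.pi fun i ↦ Ioo (-L i) (L i) := by
    ext x
    simp [openBox]
  rw [this, (PiLp.volume_preserving_ofLp (Fin m)).measure_preimage
    (MeasurableSet.univ_pi fun _ ↦ measurableSet_Ioo).nullMeasurableSet, Real.volume_pi_Ioo,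
    ENNReal.ofReal_prod_of_nonneg fun i _ ↦ by linarith [hL i]]
  congr! 2
  ring

/-- The open face of the box on which the coordinate `i` equals `L i` (if `s = true`) or `-L i`. -/
def openFace {n : ℕ} (L : Fin (n + 1) → ℝ) (p : Fin (n + 1) × Bool) : Set (Euc (n + 1)) :=
  slice p.1 (if p.2 then L p.1 else -L p.1) '' openBox (fun j ↦ L (p.1.succAbove j))

lemma openFace_subset_frontier {n : ℕ} {L : Fin (n + 1) → ℝ} (hL : ∀ i, 0 < L i)
    (p : Fin (n + 1) × Bool) : openFace L p ⊆ frontier (openBox L) := by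
  obtain ⟨i, s⟩ := p
  rintro _ ⟨y, hy, rfl⟩
  rw [(isOpen_openBox L).frontier_eq, closure_openBox hL]
  constructor
  · intro j
    refine Fin.succAboveCases i ?_ (fun k ↦ ?_) j
    · have := hL i
      cases s <;> simp <;> linarith
    · simpa using Ioo_subset_Icc_self (hy k)
  · intro h
    have := h i
    cases s <;> simp at this

lemma frontier_openBox_subset {n : ℕ} {L : Fin (n + 1) → ℝ} (hL : ∀ i, 0 < L i) :
    frontier (openBox L) ⊆ ⋃ p : Fin (n + 1) × Bool,
      slice p.1 (if p.2 then L p.1 else -L p.1) ''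
        closure (openBox fun j ↦ L (p.1.succAbove j)) := by
  intro x hx
  rw [(isOpen_openBox L).frontier_eq, closure_openBox hL] at hx
  obtain ⟨hx1, hx2⟩ := hx
  simp only [openBox, mem_ofPred_eq, not_forall] at hx2
  obtain ⟨i, hi⟩ := hx2
  have hs : ∃ s : Bool, (if s then L i else -L i) = x i := by
    have h1 := hx1 i
    by_cases h : x i = L i
    · exact ⟨true, by simp [h]⟩
    · refine ⟨false, ?_⟩
      have h2 : x i < L i := lt_of_le_of_ne h1.2 h
      have h3 : ¬ (-L i < x i) := fun h3 ↦ hi ⟨h3, h2⟩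
      simpa using le_antisymm h1.1 (not_lt.1 h3)
  obtain ⟨s, hs⟩ := hs
  obtain ⟨y, hy⟩ := exists_slice_eq i x
  refine mem_iUnion.2 ⟨(i, s), y, ?_, by simpa [hs] using hy⟩
  rw [closure_openBox fun j ↦ hL _]
  intro j
  have := hx1 (i.succAbove j)
  rw [← hy] at this
  simpa using this

lemma perimeter_openBox_lt_top {n : ℕ} {L : Fin (n + 1) → ℝ} (hL : ∀ i, 0 < L i) :
    perimeter (openBox L) < ⊤ := by
  refine (measure_mono (frontier_openBox_subset hL)).trans_lt ?_
  refine (measure_iUnion_le _).trans_lt ?_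
  rw [tsum_fintype, ENNReal.sum_lt_top]
  intro p _
  rw [surf_image_slice]
  have hsub : closure (openBox fun j ↦ L (p.1.succAbove j)) ⊆
      openBox fun j ↦ L (p.1.succAbove j) + 1 := by
    rw [closure_openBox fun j ↦ hL _]
    exact fun x hx j ↦ ⟨by linarith [(hx j).1], by linarith [(hx j).2]⟩
  refine (measure_mono hsub).trans_lt ?_
  rw [volume_openBox fun j ↦ add_pos (hL _) one_pos]
  exact ENNReal.ofReal_lt_top

lemma pairwise_disjoint_openFace {n : ℕ} {L : Fin (n + 1) → ℝ} (hL : ∀ i, 0 < L i) :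
    Pairwise (Function.onFun Disjoint (openFace L)) := by
  have hface : ∀ p x, x ∈ openFace L p →
      x p.1 = (if p.2 then L p.1 else -L p.1) ∧ ∀ j, j ≠ p.1 → x j ∈ Ioo (-L j) (L j) := by
    rintro ⟨i, s⟩ _ ⟨y, hy, rfl⟩
    refine ⟨by simp, fun j hj ↦ ?_⟩
    obtain ⟨k, rfl⟩ := Fin.exists_succAbove_eq hj
    simpa using hy k
  rintro ⟨i, s⟩ ⟨j, t⟩ hne
  refine disjoint_left.2 fun x hx hx' ↦ ?_
  obtain ⟨h1, -⟩ := hface _ _ hx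
  obtain ⟨h3, h4⟩ := hface _ _ hx'
  simp only at h1 h3 h4
  by_cases hij : i = j
  · subst hij
    have := hL i
    rw [h1] at h3
    cases s <;> cases t <;> simp at h3 hne <;> linarith
  · have := h4 i hij
    rw [h1] at this
    cases s <;> simp at this

/-- The perimeter of a box is at least (in fact equal to) `|R| ∑ i, 1 / L i`. -/
lemma le_perimeter_openBox {n : ℕ} {L : Fin (n + 1) → ℝ} (hL : ∀ i, 0 < L i) :
    ENNReal.ofReal ((∏ i, (2 * L i)) * ∑ i, (L i)⁻¹) ≤ perimeter (openBox L) := by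
  have h1 : surf (n + 1) (⋃ p, openFace L p) ≤ perimeter (openBox L) :=
    measure_mono (iUnion_subset fun p ↦ openFace_subset_frontier hL p)
  refine le_trans (le_of_eq ?_) h1
  rw [measure_iUnion (pairwise_disjoint_openFace hL) fun p ↦
    (isometry_slice _ _).isClosedEmbedding.measurableEmbedding.measurableSet_image.2
      (isOpen_openBox _).measurableSet, tsum_fintype, Fintype.sum_prod_type]
  simp only [openFace, surf_image_slice, Fintype.sum_bool]
  have h2 : ∀ i : Fin (n + 1), volume (openBox fun j ↦ L (i.succAbove j)) +
      volume (openBox fun j ↦ L (i.succAbove j)) =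
      ENNReal.ofReal ((∏ i, (2 * L i)) * (L i)⁻¹) := fun i ↦ by
    have h0 : 0 ≤ ∏ j : Fin n, (2 * L (i.succAbove j)) :=
      Finset.prod_nonneg fun j _ ↦ by linarith [hL (i.succAbove j)]
    rw [volume_openBox fun j ↦ hL _, ← ENNReal.ofReal_add h0 h0, Fin.prod_univ_succAbove _ i]
    congr 1
    have := (hL i).ne'
    field_simp
    ring
  simp only [h2]
  rw [← ENNReal.ofReal_sum_of_nonneg, Finset.mul_sum]
  intro i _
  exact mul_nonneg (Finset.prod_nonneg fun j _ ↦ by linarith [hL j]) (inv_nonneg.2 (hL i).le)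

/-- The half-lengths of the box `R_k`. -/
def halfLength (n : ℕ) (k : ℝ) (i : Fin (n + 1)) : ℝ := if (i : ℕ) + 1 = n + 1 then k else 1

lemma box_eq_openBox (n : ℕ) (k : ℝ) : box (n + 1) k = openBox (halfLength n k) := by
  ext x
  simp only [box, openBox, halfLength, mem_ofPred_eq]
  refine forall_congr' fun i ↦ ?_
  split_ifs <;> rfl

lemma halfLength_pos {n : ℕ} {k : ℝ} (hk : 0 < k) (i : Fin (n + 1)) : 0 < halfLength n k i := by
  unfold halfLength
  split_ifs <;> linarith

lemma volume_box {n : ℕ} {k : ℝ} (hk : 0 < k) :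
    volume (box (n + 1) k) = ENNReal.ofReal (2 ^ (n + 1) * k) := by
  rw [box_eq_openBox, volume_openBox (halfLength_pos hk), Fin.prod_univ_castSucc]
  have : ∀ i : Fin n, halfLength n k i.castSucc = 1 := fun i ↦ by simp [halfLength, i.2.ne]
  simp only [this]
  simp [halfLength]
  ring_nf

lemma le_perimeter_box {n : ℕ} {k : ℝ} (hk : 0 < k) :
    ENNReal.ofReal (2 ^ (n + 1) * k * (n + k⁻¹)) ≤ perimeter (box (n + 1) k) := by
  rw [box_eq_openBox]
  refine le_trans (le_of_eq ?_) (le_perimeter_openBox (halfLength_pos hk))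
  rw [Fin.prod_univ_castSucc, Fin.sum_univ_castSucc]
  have : ∀ i : Fin n, halfLength n k i.castSucc = 1 := fun i ↦ by simp [halfLength, i.2.ne]
  simp only [this]
  simp [halfLength]
  ring_nf

lemma perimeter_box_lt_top {n : ℕ} {k : ℝ} (hk : 0 < k) : perimeter (box (n + 1) k) < ⊤ := by
  rw [box_eq_openBox]
  exact perimeter_openBox_lt_top (halfLength_pos hk)

lemma ball_subset_box {n : ℕ} {k : ℝ} (hk : 1 ≤ k) :
    Metric.ball 0 1 ⊆ box (n + 1) k := by
  intro x hx i
  have hx1 : ‖x‖ < 1 := by simpa using hx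
  have := abs_lt.1 ((PiLp.norm_apply_le x i).trans_lt hx1)
  split_ifs
  · exact ⟨by linarith [this.1], by linarith [this.2]⟩
  · exact this

lemma volume_ball_le (n : ℕ) :
    volume.real (Metric.ball (0 : Euc (n + 1)) 1) ≤ 2 ^ (n + 1) := by
  have h : volume (Metric.ball (0 : Euc (n + 1)) 1) ≤ ENNReal.ofReal (2 ^ (n + 1) * 1) :=
    (measure_mono (ball_subset_box le_rfl)).trans (volume_box one_pos).le
  simpa [Measure.real] using ENNReal.toReal_le_of_le_ofReal (by positivity) h

/-- The isoperimetric inequality for the box: the ball whose perimeter is that of `R_k` has the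
larger volume. -/
lemma volume_box_lt_of_perimeter_eq {n : ℕ} (hn : 1 ≤ n) {k β : ℝ} (hk : 1 < k) (hβ : 0 < β)
    (h : perimeter (originBall (n + 1) β) = perimeter (box (n + 1) k)) :
    2 ^ (n + 1) * k < β ^ (n + 1) * volume.real (Metric.ball (0 : Euc (n + 1)) 1) := by
  have hk0 : 0 < k := by linarith
  set w := volume.real (Metric.ball (0 : Euc (n + 1)) 1) with hw
  set V : ℝ := 2 ^ (n + 1) * k with hV
  have hV0 : 0 < V := by positivity
  have hw0 : 0 < w := ENNReal.toReal_pos (Metric.measure_ball_pos _ _ one_pos).ne'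
    measure_ball_lt_top.ne
  have h1 : V * (n + k⁻¹) ≤ (n + 1) * w * β ^ n := by
    have := (le_perimeter_box (n := n) hk0).trans (h.symm.trans (perimeter_originBall hβ)).le
    have := this.trans (mul_le_mul_right (surf_sphere_le n) _)
    rw [ENNReal.ofReal_le_iff_le_toReal (ENNReal.mul_ne_top ENNReal.ofReal_ne_top
      (ENNReal.mul_ne_top ENNReal.ofReal_ne_top measure_ball_lt_top.ne)), ENNReal.toReal_mul,
      ENNReal.toReal_mul, ENNReal.toReal_ofReal (by positivity),
      ENNReal.toReal_ofReal (by positivity)] at this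
    rw [hw, Measure.real]
    linarith
  -- Bernoulli's inequality is the inequality of arithmetic and geometric means for `1, …, 1, 1/k`.
  have h2 : ((n : ℝ) + 1) ^ (n + 1) * k⁻¹ < (n + k⁻¹) ^ (n + 1) := by
    have hk1 : k⁻¹ < 1 := inv_lt_one_of_one_lt₀ hk
    have hk2 : 0 < k⁻¹ := by positivity
    have hn1 : (0 : ℝ) < n + 1 := by positivity
    have hb := one_add_mul_self_lt_rpow_one_add (s := (k⁻¹ - 1) / (n + 1)) (p := ((n + 1 : ℕ) : ℝ))
      (by rw [le_div_iff₀ hn1]; nlinarith) (by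
        refine div_ne_zero ?_ hn1.ne'
        linarith) (by exact_mod_cast Nat.lt_add_of_pos_left hn)
    rw [Real.rpow_natCast] at hb
    have e1 : 1 + ((n + 1 : ℕ) : ℝ) * ((k⁻¹ - 1) / (n + 1)) = k⁻¹ := by
      push_cast
      field_simp
      ring
    have e2 : (n : ℝ) + k⁻¹ = (n + 1) * (1 + (k⁻¹ - 1) / (n + 1)) := by
      field_simp
      ring
    rw [e1] at hb
    rw [e2, mul_pow]
    gcongr
  -- If `w β ^ (n + 1) ≤ V`, the two bounds on the perimeter give `2 ^ (n + 1) < w`, although the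
  -- unit ball lies in the cube of side `2`.
  by_contra! hcon
  have h3 : (V * (n + k⁻¹)) ^ (n + 1) ≤ ((n + 1) * w * β ^ n) ^ (n + 1) :=
    pow_le_pow_left₀ (by positivity) h1 _
  have h4 : (β ^ (n + 1) * w) ^ n ≤ V ^ n := pow_le_pow_left₀ (by positivity) hcon _
  have h5 : ((n + 1) * w * β ^ n) ^ (n + 1) =
      ((n : ℝ) + 1) ^ (n + 1) * w * (β ^ (n + 1) * w) ^ n := by
    rw [mul_pow, mul_pow, mul_pow]
    ring
  have h6 : V ^ (n + 1) * (((n : ℝ) + 1) ^ (n + 1) * k⁻¹) < V ^ (n + 1) * (n + k⁻¹) ^ (n + 1) := by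
    gcongr
  have h7 : V ^ (n + 1) * (((n : ℝ) + 1) ^ (n + 1) * k⁻¹) =
      ((n : ℝ) + 1) ^ (n + 1) * 2 ^ (n + 1) * V ^ n := by
    rw [pow_succ V, hV]
    field_simp
  have h8 : ((n : ℝ) + 1) ^ (n + 1) * w * (β ^ (n + 1) * w) ^ n ≤
      ((n : ℝ) + 1) ^ (n + 1) * 2 ^ (n + 1) * V ^ n := by
    gcongr
    exact volume_ball_le n
  rw [mul_pow] at h3
  linarith

/-! ### Upper bounds for the first eigenvalue -/

/-- The Rayleigh quotients of all admissible functions; `firstEigenvalue` is the infimum of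
this set. -/
def rayleighQuotients {N : ℕ} (Ωin Ωout : Set (Euc N)) (hin hout : ℝ≥0∞) : Set ℝ :=
  {q : ℝ | ∃ (v : Euc N → ℝ) (g : Euc N → Euc N) (T : Euc N → ℝ),
    MemH1 (annular Ωin Ωout) v g ∧ IsTrace (annular Ωin Ωout) v g T ∧
    ¬ (v =ᵐ[volume.restrict (annular Ωin Ωout)] 0) ∧
    (hin = ⊤ → T =ᵐ[(surf N).restrict (frontier Ωin)] 0) ∧
    (hout = ⊤ → T =ᵐ[(surf N).restrict (frontier Ωout)] 0) ∧
    q = robinEnergy Ωin Ωout hin hout g T / ∫ x in annular Ωin Ωout, v x ^ 2}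

lemma robinEnergy_nonneg {N : ℕ} (Ωin Ωout : Set (Euc N)) (hin hout : ℝ≥0∞)
    (g : Euc N → Euc N) (T : Euc N → ℝ) : 0 ≤ robinEnergy Ωin Ωout hin hout g T := by
  refine add_nonneg (add_nonneg (integral_nonneg fun x ↦ by positivity) ?_) ?_ <;>
  exact mul_nonneg ENNReal.toReal_nonneg (integral_nonneg fun x ↦ by positivity)

lemma bddBelow_rayleighQuotients {N : ℕ} (Ωin Ωout : Set (Euc N)) (hin hout : ℝ≥0∞) :
    BddBelow (rayleighQuotients Ωin Ωout hin hout) := by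
  refine ⟨0, ?_⟩
  rintro q ⟨v, g, T, -, -, -, -, -, rfl⟩
  exact div_nonneg (robinEnergy_nonneg _ _ _ _ _ _) (integral_nonneg fun x ↦ by positivity)

lemma continuous_gradient {N : ℕ} {w : Euc N → ℝ} (hw : ContDiff ℝ ∞ w) : Continuous (∇ w) :=
  (InnerProductSpace.toDual ℝ (Euc N)).symm.continuous.comp (hw.continuous_fderiv (by simp))

lemma norm_gradient {N : ℕ} (w : Euc N → ℝ) (x : Euc N) : ‖∇ w x‖ = ‖fderiv ℝ w x‖ := by
  simp [gradient]

/-- A smooth function with compact support in the open set `Ω` is a competitor for the first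
eigenvalue, whatever the boundary conditions: its trace is zero. -/
lemma mem_rayleighQuotients {N : ℕ} {Ωin Ωout : Set (Euc N)} (hin hout : ℝ≥0∞)
    (hΩ : IsOpen Ωout) {w : Euc N → ℝ} (hw : ContDiff ℝ ∞ w) (hc : HasCompactSupport w)
    (hs : tsupport w ⊆ annular Ωin Ωout) (h0 : 0 < ∫ x, w x ^ 2) :
    (∫ x, ‖∇ w x‖ ^ 2) / ∫ x, w x ^ 2 ∈ rayleighQuotients Ωin Ωout hin hout := by
  have hopen : IsOpen (annular Ωin Ωout) := hΩ.sdiff isClosed_closure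
  have hgc : Continuous (∇ w) := continuous_gradient hw
  have hfz : ∀ x ∉ tsupport w, fderiv ℝ w x = 0 := fun x hx ↦ by
    by_contra h
    exact hx (support_fderiv_subset ℝ h)
  have hgs : HasCompactSupport (∇ w) :=
    HasCompactSupport.intro hc fun x hx ↦ by simp [gradient, hfz x hx]
  have hwz : ∀ x ∉ annular Ωin Ωout, w x = 0 := fun x hx ↦
    image_eq_zero_of_notMem_tsupport fun h ↦ hx (hs h)
  have hgz : ∀ x ∉ annular Ωin Ωout, ∇ w x = 0 := fun x hx ↦ by
    simp [gradient, hfz x fun h ↦ hx (hs h)]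
  have hw2 : ∫ x in annular Ωin Ωout, w x ^ 2 = ∫ x, w x ^ 2 :=
    setIntegral_eq_integral_of_forall_compl_eq_zero fun x hx ↦ by simp [hwz x hx]
  have hg2 : ∫ x in annular Ωin Ωout, ‖∇ w x‖ ^ 2 = ∫ x, ‖∇ w x‖ ^ 2 :=
    setIntegral_eq_integral_of_forall_compl_eq_zero fun x hx ↦ by simp [hgz x hx]
  refine ⟨w, ∇ w, 0, ⟨?_, ?_, ?_⟩, ⟨MemLp.zero, fun _ ↦ w, fun _ ↦ hw, ?_, ?_, ?_⟩, ?_,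
    fun _ ↦ ae_eq_rfl, fun _ ↦ ae_eq_rfl, ?_⟩
  · exact (hw.continuous.memLp_of_hasCompactSupport hc).restrict _
  · exact (hgc.memLp_of_hasCompactSupport hgs).restrict _
  · intro φ hφ hφc _ e
    rw [setIntegral_eq_integral_of_forall_compl_eq_zero fun x hx ↦ by simp [hwz x hx],
      setIntegral_eq_integral_of_forall_compl_eq_zero fun x hx ↦ by simp [hgz x hx]]
    simp only [inner_gradient_left]
    have hdw : Continuous fun x ↦ fderiv ℝ w x e :=
      (hw.continuous_fderiv (by simp)).clm_apply continuous_const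
    have hdφ : Continuous fun x ↦ fderiv ℝ φ x e :=
      (hφ.continuous_fderiv (by simp)).clm_apply continuous_const
    exact integral_mul_fderiv_eq_neg_fderiv_mul_of_integrable
      ((hdw.mul hφ.continuous).integrable_of_hasCompactSupport hφc.mul_left)
      ((hw.continuous.mul hdφ).integrable_of_hasCompactSupport hc.mul_right)
      ((hw.continuous.mul hφ.continuous).integrable_of_hasCompactSupport hc.mul_right)
      (fun x _ ↦ hw.differentiable (by simp) x) (fun x _ ↦ hφ.differentiable (by simp) x)
  · simp
  · simp
  · have : (fun x ↦ w x - (0 : Euc N → ℝ) x) =ᵐ[(surf N).restrict (frontier (annular Ωin Ωout))]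
        (fun _ ↦ (0 : ℝ)) := by
      filter_upwards [self_mem_ae_restrict isClosed_frontier.measurableSet] with x hx
      rw [hopen.frontier_eq] at hx
      simp [hwz x hx.2]
    simp only [eLpNorm_congr_ae this]
    simp
  · intro h
    rw [← hw2, integral_eq_zero_of_ae] at h0
    · exact h0.ne rfl
    · filter_upwards [h] with x hx
      simp [hx]
  · simp [robinEnergy, hg2, hw2]

/-- Translating and dilating a fixed bump gives smooth functions with arbitrarily small Rayleigh
quotient, supported in any ball of a suitable radius. -/
lemma exists_smooth_small_quotient (N : ℕ) {ε : ℝ} (hε : 0 < ε) :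
    ∃ ρ : ℝ, 0 < ρ ∧ ∀ c : Euc N, ∃ w : Euc N → ℝ, ContDiff ℝ ∞ w ∧
      tsupport w ⊆ Metric.closedBall c ρ ∧ 0 < ∫ x, w x ^ 2 ∧
      (∫ x, ‖∇ w x‖ ^ 2) / (∫ x, w x ^ 2) < ε := by
  let f : ContDiffBump (0 : Euc N) := default
  have hf : ContDiff ℝ ∞ f := f.contDiff
  set A := ∫ x, f x ^ 2
  set B := ∫ x, ‖∇ f x‖ ^ 2
  have hA : 0 < A := by
    refine (hf.continuous.pow 2).integral_pos_of_hasCompactSupport_nonneg_nonzero (x := 0) ?_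
      (fun x ↦ sq_nonneg _) ?_
    · exact f.hasCompactSupport.comp_left (g := fun t : ℝ ↦ t ^ 2) (by simp)
    · simp [f.one_of_mem_closedBall (by simpa using f.rIn_pos.le : (0 : Euc N) ∈ _)]
  have hB : 0 ≤ B := integral_nonneg fun x ↦ by positivity
  obtain ⟨t, ht, hlt⟩ : ∃ t : ℝ, 0 < t ∧ t ^ 2 * (B / A) < ε := by
    have : Tendsto (fun t : ℝ ↦ t ^ 2 * (B / A)) (𝓝[>] 0) (𝓝 0) := by
      refine Tendsto.mono_left ?_ nhdsWithin_le_nhds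
      have : Continuous fun t : ℝ ↦ t ^ 2 * (B / A) := by fun_prop
      simpa using this.tendsto 0
    obtain ⟨t, h1, h2⟩ := ((this.eventually_lt_const hε).and self_mem_nhdsWithin).exists
    exact ⟨t, h2, h1⟩
  refine ⟨f.rOut / t, div_pos f.rOut_pos ht, fun c ↦ ?_⟩
  set w : Euc N → ℝ := fun x ↦ f (t • (x - c)) with hwdef
  have hwg : ∀ x, ‖∇ w x‖ ^ 2 = t ^ 2 * ‖∇ f (t • (x - c))‖ ^ 2 := fun x ↦ by
    have h1 : fderiv ℝ w x = t • fderiv ℝ f (t • (x - c)) := by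
      rw [hwdef, fderiv_comp_sub (f := fun y ↦ f (t • y)), fderiv_comp_smul]
    rw [norm_gradient, norm_gradient, h1, norm_smul, mul_pow, Real.norm_eq_abs, sq_abs]
  have hscale : ∀ F : Euc N → ℝ, ∫ x, F (t • (x - c)) =
      |(t ^ Module.finrank ℝ (Euc N))⁻¹| * ∫ x, F x := fun F ↦ by
    rw [integral_sub_right_eq_self (fun x ↦ F (t • x)), Measure.integral_comp_smul, smul_eq_mul]
  set J := |(t ^ Module.finrank ℝ (Euc N))⁻¹|
  have hJ : 0 < J := by positivity
  have e1 : ∫ x, w x ^ 2 = J * A := hscale fun x ↦ f x ^ 2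
  have e2 : ∫ x, ‖∇ w x‖ ^ 2 = t ^ 2 * (J * B) := by
    simp only [hwg]
    rw [integral_const_mul, hscale fun x ↦ ‖∇ f x‖ ^ 2]
  refine ⟨w, by fun_prop, ?_, ?_, ?_⟩
  · refine closure_minimal (fun x hx ↦ ?_) Metric.isClosed_closedBall
    have h : t • (x - c) ∈ Function.support f := hx
    rw [f.support_eq, mem_ball_zero_iff, norm_smul, Real.norm_of_nonneg ht.le] at h
    rw [mem_closedBall_iff_norm, le_div_iff₀ ht]
    linarith
  · rw [e1]
    positivity
  · rw [e1, e2]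
    convert hlt using 1
    field_simp

/-- The first eigenvalue is small as soon as the domain contains a large ball. -/
lemma exists_firstEigenvalue_lt (N : ℕ) {ε : ℝ} (hε : 0 < ε) :
    ∃ ρ : ℝ, 0 < ρ ∧ ∀ (c : Euc N) (Ωin Ωout : Set (Euc N)) (hin hout : ℝ≥0∞), IsOpen Ωout →
      Metric.closedBall c ρ ⊆ annular Ωin Ωout → firstEigenvalue Ωin Ωout hin hout < ε := by
  obtain ⟨ρ, hρ, h⟩ := exists_smooth_small_quotient N hε
  refine ⟨ρ, hρ, fun c Ωin Ωout hin hout hΩ hc ↦ ?_⟩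
  obtain ⟨w, hw, hs, h0, hlt⟩ := h c
  refine (csInf_le (bddBelow_rayleighQuotients Ωin Ωout hin hout) ?_).trans_lt hlt
  exact mem_rayleighQuotients hin hout hΩ hw
    ((isCompact_closedBall c ρ).of_isClosed_subset (isClosed_tsupport w) hs) (hs.trans hc) h0

lemma rayleighQuotients_nonempty {N : ℕ} {Ωin Ωout : Set (Euc N)} (hin hout : ℝ≥0∞)
    (hΩ : IsOpen Ωout) (hne : (annular Ωin Ωout).Nonempty) :
    (rayleighQuotients Ωin Ωout hin hout).Nonempty := by
  obtain ⟨c, hc⟩ := hne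
  obtain ⟨f, hf⟩ : ∃ f : ContDiffBump c, tsupport f ⊆ annular Ωin Ωout := by
    obtain ⟨r, hr, hrs⟩ := Metric.nhds_basis_closedBall.mem_iff.1
      ((hΩ.sdiff isClosed_closure).mem_nhds hc)
    exact ⟨⟨r / 2, r, half_pos hr, half_lt_self hr⟩, by
      rwa [ContDiffBump.tsupport_eq]⟩
  refine ⟨_, mem_rayleighQuotients hin hout hΩ f.contDiff f.hasCompactSupport hf ?_⟩
  refine (f.continuous.pow 2).integral_pos_of_hasCompactSupport_nonneg_nonzero (x := c) ?_
    (fun x ↦ sq_nonneg _) ?_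
  · exact f.hasCompactSupport.comp_left (g := fun t : ℝ ↦ t ^ 2) (by simp)
  · simp [f.one_of_mem_closedBall (by simpa using f.rIn_pos.le : c ∈ _)]

/-! ### A Poincaré inequality with boundary term on the box minus a ball -/

/-- The Cauchy-Schwarz inequality for the increment of a `C¹` function over an interval of length at
most one. -/
lemma sq_sub_le_integral_deriv_sq {u u' : ℝ → ℝ} (hu : ∀ t, HasDerivAt u (u' t) t)
    (hu' : Continuous u') {a b : ℝ} (hab : a ≤ b) (hl : b - a ≤ 1) :
    (u b - u a) ^ 2 ≤ ∫ t in a..b, u' t ^ 2 := by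
  set A := u b - u a with hA
  have hFTC : ∫ t in a..b, u' t = A :=
    intervalIntegral.integral_eq_sub_of_hasDerivAt (fun t _ ↦ hu t) (hu'.intervalIntegrable _ _)
  -- Expanding `∫ (u' - A) ^ 2 ≥ 0` gives `(2 - (b - a)) * A ^ 2 ≤ ∫ u' ^ 2`.
  have h0 : 0 ≤ ∫ t in a..b, (u' t - A) ^ 2 :=
    intervalIntegral.integral_nonneg hab fun t _ ↦ sq_nonneg _
  have h1 : ∫ t in a..b, (u' t - A) ^ 2 =
      (∫ t in a..b, u' t ^ 2) - 2 * A * A + (b - a) * A ^ 2 := by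
    have : ∀ t, (u' t - A) ^ 2 = (u' t ^ 2 - 2 * A * u' t) + A ^ 2 := fun t ↦ by ring
    simp only [this]
    rw [intervalIntegral.integral_add, intervalIntegral.integral_sub,
      intervalIntegral.integral_const_mul, hFTC, intervalIntegral.integral_const, smul_eq_mul]
    all_goals exact Continuous.intervalIntegrable (by fun_prop) _ _
  nlinarith [sq_nonneg A]

lemma ofReal_intervalIntegral_sq_le {u' : ℝ → ℝ} (hu' : Continuous u') {a b : ℝ} (hab : a ≤ b)
    {U : Set ℝ} (hU : Ioo a b ⊆ U) :
    ENNReal.ofReal (∫ t in a..b, u' t ^ 2) ≤ ∫⁻ t in U, ‖u' t‖ₑ ^ 2 := by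
  rw [intervalIntegral.integral_of_le hab, integral_Ioc_eq_integral_Ioo,
    ofReal_integral_eq_lintegral_ofReal]
  · refine (lintegral_mono_set hU).trans_eq' (lintegral_congr fun t ↦ ?_)
    rw [← Real.enorm_eq_ofReal (sq_nonneg _), enorm_pow]
  · exact ((hu'.pow 2).integrableOn_Icc (a := a) (b := b)).mono_set Ioo_subset_Icc_self
  · exact ae_of_all _ fun t ↦ sq_nonneg _

/-- A one-dimensional Poincaré inequality with boundary terms, on a part `U` of `(-1, 1)` from each
point of which one can reach `1` or `-1` without leaving `U`. -/
lemma setLIntegral_sq_le {u u' : ℝ → ℝ} (hu : ∀ t, HasDerivAt u (u' t) t)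
    (hu' : Continuous u') {U : Set ℝ} (hU : U ⊆ Ioo (-1) 1) (hUm : MeasurableSet U)
    (hr : ∀ t ∈ U, 0 ≤ t → Ioo t 1 ⊆ U) (hl : ∀ t ∈ U, t ≤ 0 → Ioo (-1) t ⊆ U) :
    ∫⁻ t in U, ‖u t‖ₑ ^ 2 ≤
      4 * (‖u 1‖ₑ ^ 2 + ‖u (-1)‖ₑ ^ 2) + 4 * ∫⁻ t in U, ‖u' t‖ₑ ^ 2 := by
  set I := ∫⁻ t in U, ‖u' t‖ₑ ^ 2
  set E := ‖u 1‖ₑ ^ 2 + ‖u (-1)‖ₑ ^ 2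
  have hsq : ∀ x : ℝ, ‖x‖ₑ ^ 2 = ENNReal.ofReal (x ^ 2) := fun x ↦ by
    rw [← enorm_pow, Real.enorm_eq_ofReal (sq_nonneg _)]
  have hsplit : ∀ x y J : ℝ, (y - x) ^ 2 ≤ J → ‖x‖ₑ ^ 2 ≤ 2 * ‖y‖ₑ ^ 2 + 2 * ENNReal.ofReal J := by
    intro x y J h
    have hJ : 0 ≤ J := (sq_nonneg _).trans h
    rw [hsq, hsq, show (2 : ℝ≥0∞) = ENNReal.ofReal 2 by simp, ← ENNReal.ofReal_mul (by simp),
      ← ENNReal.ofReal_mul (by simp), ← ENNReal.ofReal_add (by positivity) (by positivity)]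
    exact ENNReal.ofReal_le_ofReal (by nlinarith [sq_nonneg (2 * y - x)])
  -- A point of `U` is compared with the endpoint on its own side of the origin, which is at
  -- distance at most `1`.
  have hpt : ∀ t ∈ U, ‖u t‖ₑ ^ 2 ≤ 2 * E + 2 * I := by
    intro t ht
    obtain ⟨ht1, ht2⟩ := hU ht
    rcases le_total 0 t with h0 | h0
    · refine (hsplit _ _ _ (sq_sub_le_integral_deriv_sq hu hu' ht2.le (by linarith))).trans ?_
      gcongr
      · exact le_self_add
      · exact ofReal_intervalIntegral_sq_le hu' ht2.le (hr t ht h0)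
    · have h := sq_sub_le_integral_deriv_sq hu hu' ht1.le (by linarith)
      rw [← neg_sq, neg_sub] at h
      refine (hsplit _ _ _ h).trans ?_
      gcongr
      · exact le_add_self
      · exact ofReal_intervalIntegral_sq_le hu' ht1.le (hl t ht h0)
  have hvol : volume U ≤ 2 := (measure_mono hU).trans_eq (by simp; norm_num)
  calc ∫⁻ t in U, ‖u t‖ₑ ^ 2 ≤ ∫⁻ _ in U, (2 * E + 2 * I) := setLIntegral_mono' hUm hpt
    _ = (2 * E + 2 * I) * volume U := setLIntegral_const _ _
    _ ≤ (2 * E + 2 * I) * 2 := by gcongr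
    _ = 4 * E + 4 * I := by ring

lemma setLIntegral_eq_lintegral_slice {n : ℕ} {Ω : Set (Euc (n + 1))} (hΩ : MeasurableSet Ω)
    {F : Euc (n + 1) → ℝ≥0∞} (hF : Measurable F) :
    ∫⁻ x in Ω, F x = ∫⁻ y : Euc n, ∫⁻ t in {t | slice 0 t y ∈ Ω}, F (slice 0 t y) := by
  have hm : Measurable (fun p : ℝ × Euc n ↦ slice 0 p.1 p.2) := (continuous_slice 0).measurable
  rw [← (measurePreserving_slice 0).setLIntegral_comp_preimage hΩ hF,
    ← lintegral_indicator (hm hΩ), Measure.volume_eq_prod, lintegral_prod_symm]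
  · refine lintegral_congr fun y ↦ ?_
    rw [← lintegral_indicator]
    · rfl
    · exact (hm.comp measurable_prodMk_right) hΩ
  · exact ((hF.comp hm).indicator (hm hΩ)).aemeasurable

lemma setLIntegral_slice_le {n : ℕ} (c : ℝ) {B : Set (Euc n)} (hB : MeasurableSet B)
    {Γ : Set (Euc (n + 1))} (hΓ : slice 0 c '' B ⊆ Γ) {F : Euc (n + 1) → ℝ≥0∞}
    (hF : Measurable F) :
    ∫⁻ y in B, F (slice 0 c y) ≤ ∫⁻ x in Γ, F x ∂(surf (n + 1)) := by
  have hemb := (isometry_slice (n := n) 0 c).isClosedEmbedding.measurableEmbedding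
  calc ∫⁻ y in B, F (slice 0 c y)
      = ∫⁻ x in slice 0 c '' B, F x ∂(volume.map (slice 0 c)) := by
        rw [setLIntegral_map (hemb.measurableSet_image.2 hB) hF hemb.measurable,
          preimage_image_eq _ (isometry_slice 0 c).injective]
    _ ≤ ∫⁻ x in Γ, F x ∂(surf (n + 1)) := by
        rw [map_slice_volume]
        exact lintegral_mono' (Measure.restrict_mono hΓ Measure.restrict_le_self) le_rfl

lemma hasDerivAt_slice {n : ℕ} (i : Fin (n + 1)) (y : Euc n) (t : ℝ) :
    HasDerivAt (fun t ↦ slice i t y) (slice i 1 0) t := by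
  have h : (fun t ↦ slice i t y) = fun t : ℝ ↦ slice i 0 y + t • slice i 1 0 := by
    funext t
    ext j
    refine Fin.succAboveCases i ?_ (fun k ↦ ?_) j <;> simp
  rw [h]
  simpa using ((hasDerivAt_id t).smul_const (slice i 1 (0 : Euc n))).const_add (slice i 0 y)

lemma norm_slice_one_zero {n : ℕ} (i : Fin (n + 1)) : ‖slice i 1 (0 : Euc n)‖ = 1 := by
  have := norm_slice_sq i 1 (0 : Euc n)
  simpa using (pow_eq_one_iff_of_nonneg (norm_nonneg _) two_ne_zero).1 (by simpa using this)

/-- The Poincaré inequality with boundary term on the box minus a centered ball, for smooth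
functions. The constants do not depend on the other half-lengths of the box: from each point one
reaches one of the faces `{x 0 = ± 1}` along a segment in the direction of the first coordinate axis
that moves away from the hole. -/
lemma lintegral_sq_le_of_contDiff {n : ℕ} {L : Fin (n + 1) → ℝ} (hL : ∀ i, 0 < L i) (hL0 : L 0 = 1)
    (α : ℝ) {φ : Euc (n + 1) → ℝ} (hφ : ContDiff ℝ ∞ φ) :
    ∫⁻ x in openBox L \ Metric.closedBall 0 α, ‖φ x‖ₑ ^ 2 ≤
      8 * (∫⁻ x in frontier (openBox L), ‖φ x‖ₑ ^ 2 ∂(surf (n + 1))) +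
        4 * ∫⁻ x in openBox L \ Metric.closedBall 0 α, ‖∇ φ x‖ₑ ^ 2 := by
  set Ω := openBox L \ Metric.closedBall 0 α with hΩdef
  have hΩ : MeasurableSet Ω :=
    ((isOpen_openBox L).sdiff Metric.isClosed_closedBall).measurableSet
  set B : Set (Euc n) := openBox fun j ↦ L ((0 : Fin (n + 1)).succAbove j) with hB
  have hBm : MeasurableSet B := (isOpen_openBox _).measurableSet
  have hslice : ∀ (t : ℝ) (y : Euc n),
      slice 0 t y ∈ Ω ↔ (t ∈ Ioo (-1) 1 ∧ y ∈ B) ∧ α < ‖slice 0 t y‖ := fun t y ↦ by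
    have : slice 0 t y ∈ openBox L ↔ t ∈ Ioo (-1) 1 ∧ y ∈ B := by
      constructor
      · intro h
        exact ⟨by simpa [hL0] using h 0, fun j ↦ by
          have := h ((0 : Fin (n + 1)).succAbove j)
          rwa [slice_apply_succAbove] at this⟩
      · rintro ⟨h1, h2⟩ j
        refine Fin.succAboveCases 0 ?_ (fun k ↦ ?_) j
        · simpa [hL0] using h1
        · rw [slice_apply_succAbove]
          exact h2 k
    rw [hΩdef, Set.mem_sdiff, this]
    simp
  have hmono : ∀ (s t : ℝ) (y : Euc n), t ^ 2 ≤ s ^ 2 → ‖slice 0 t y‖ ≤ ‖slice 0 s y‖ :=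
    fun s t y h ↦ by
      refine (sq_le_sq₀ (norm_nonneg _) (norm_nonneg _)).1 ?_
      rw [norm_slice_sq, norm_slice_sq]
      linarith
  have hF : Measurable fun x ↦ ‖φ x‖ₑ ^ 2 := hφ.continuous.measurable.enorm.pow_const 2
  have hG : Measurable fun x ↦ ‖∇ φ x‖ₑ ^ 2 := 
    (continuous_gradient hφ).measurable.enorm.pow_const 2
  have hGm : ∀ c, Measurable fun y : Euc n ↦ ‖φ (slice 0 c y)‖ₑ ^ 2 := fun c ↦
    hF.comp (isometry_slice 0 c).continuous.measurable
  -- The one-dimensional inequality on the line through `y` parallel to the first coordinate axis.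
  have hline : ∀ y : Euc n, ∫⁻ t in {t | slice 0 t y ∈ Ω}, ‖φ (slice 0 t y)‖ₑ ^ 2 ≤
      B.indicator (fun y ↦ 4 * (‖φ (slice 0 1 y)‖ₑ ^ 2 + ‖φ (slice 0 (-1) y)‖ₑ ^ 2)) y +
        4 * ∫⁻ t in {t | slice 0 t y ∈ Ω}, ‖∇ φ (slice 0 t y)‖ₑ ^ 2 := by
    intro y
    by_cases hy : y ∈ B
    · rw [indicator_of_mem hy]
      have hcont : Continuous fun t : ℝ ↦ slice 0 t y :=
        (continuous_slice 0).comp (by fun_prop : Continuous fun t : ℝ ↦ (t, y))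
      have hd : ∀ t, HasDerivAt (fun t ↦ φ (slice 0 t y))
          (fderiv ℝ φ (slice 0 t y) (slice 0 1 0)) t := fun t ↦
        ((hφ.differentiable (by simp) _).hasFDerivAt).comp_hasDerivAt t (hasDerivAt_slice 0 y t)
      have hdc : Continuous fun t ↦ fderiv ℝ φ (slice 0 t y) (slice 0 1 0) :=
        ((hφ.continuous_fderiv (by simp)).comp hcont).clm_apply continuous_const
      refine (setLIntegral_sq_le hd hdc (U := {t | slice 0 t y ∈ Ω}) (fun t ht ↦
        ((hslice t y).1 ht).1.1) (hcont.measurable hΩ) ?_ ?_).trans ?_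
      · intro t ht h0 s hs
        have h := (hslice t y).1 ht
        refine (hslice s y).2 ⟨⟨⟨by linarith [hs.1], hs.2⟩, hy⟩, h.2.trans_le (hmono s t y ?_)⟩
        nlinarith [hs.1]
      · intro t ht h0 s hs
        have h := (hslice t y).1 ht
        refine (hslice s y).2 ⟨⟨⟨hs.1, by linarith [hs.2]⟩, hy⟩, h.2.trans_le (hmono s t y ?_)⟩
        nlinarith [hs.2]
      · gcongr with t
        have := (fderiv ℝ φ (slice 0 t y)).le_opNorm (slice 0 1 0)
        rw [norm_slice_one_zero, mul_one, ← norm_gradient] at this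
        exact enorm_le_iff_norm_le.2 this
    · have : {t | slice 0 t y ∈ Ω} = ∅ := by
        ext t
        simp [hslice, hy]
      simp [this]
  rw [setLIntegral_eq_lintegral_slice hΩ hF, setLIntegral_eq_lintegral_slice hΩ hG]
  refine (lintegral_mono hline).trans ?_
  rw [lintegral_add_left, lintegral_indicator hBm, lintegral_const_mul' _ _ (by simp),
    lintegral_const_mul' _ _ (by simp), lintegral_add_left (hGm 1)]
  · gcongr ?_ + _
    have hface : ∀ s : Bool, slice 0 (if s then 1 else -1) '' B ⊆ frontier (openBox L) := fun s ↦ by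
      have := openFace_subset_frontier hL (0, s)
      rwa [openFace, hL0] at this
    -- Each face is bounded by the whole boundary, whence the factor `8 = 2 * 4`.
    have h1 := setLIntegral_slice_le 1 hBm (by simpa using hface true) hF
    have h2 := setLIntegral_slice_le (-1) hBm (by simpa using hface false) hF
    refine (mul_le_mul_right (add_le_add h1 h2) 4).trans_eq ?_
    ring
  · exact (((hGm 1).add (hGm (-1))).const_mul 4).indicator hBm

lemma tendsto_eLpNorm_of_tendsto_sub {X E : Type*} [MeasurableSpace X] [NormedAddCommGroup E]
    {μ : Measure X} {f : ℕ → X → E} {g : X → E} (hf : ∀ n, AEStronglyMeasurable (f n) μ)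
    (hg : MemLp g 2 μ) (h : Tendsto (fun n ↦ eLpNorm (fun x ↦ f n x - g x) 2 μ) atTop (𝓝 0)) :
    Tendsto (fun n ↦ eLpNorm (f n) 2 μ) atTop (𝓝 (eLpNorm g 2 μ)) := by
  have h1 : Tendsto (fun n ↦ eLpNorm g 2 μ - eLpNorm (fun x ↦ f n x - g x) 2 μ) atTop
      (𝓝 (eLpNorm g 2 μ)) := by
    simpa using ENNReal.Tendsto.sub (tendsto_const_nhds (x := eLpNorm g 2 μ)) h
      (Or.inl hg.eLpNorm_ne_top)
  have h2 : Tendsto (fun n ↦ eLpNorm g 2 μ + eLpNorm (fun x ↦ f n x - g x) 2 μ) atTop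
      (𝓝 (eLpNorm g 2 μ)) := by
    simpa using (tendsto_const_nhds (x := eLpNorm g 2 μ)).add h
  refine tendsto_of_tendsto_of_tendsto_of_le_of_le h1 h2 (fun n ↦ ?_) fun n ↦ ?_
  · refine tsub_le_iff_right.2 ?_
    have := eLpNorm_sub_le (hf n) ((hf n).sub hg.1) (p := 2) (by norm_num)
    rwa [sub_sub_cancel] at this
  · have := eLpNorm_add_le hg.1 ((hf n).sub hg.1) (p := 2) (by norm_num)
    rwa [add_sub_cancel] at this

lemma lintegral_enorm_sq_eq {X E : Type*} [MeasurableSpace X] [NormedAddCommGroup E]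
    (μ : Measure X) (f : X → E) : ∫⁻ x, ‖f x‖ₑ ^ 2 ∂μ = eLpNorm f 2 μ ^ 2 := by
  have := eLpNorm_nnreal_pow_eq_lintegral (μ := μ) (f := f) (p := 2) (by norm_num)
  simpa using this.symm

lemma integral_norm_sq_eq {X E : Type*} [MeasurableSpace X] [NormedAddCommGroup E]
    {μ : Measure X} {f : X → E} (hf : MemLp f 2 μ) :
    ∫ x, ‖f x‖ ^ 2 ∂μ = (eLpNorm f 2 μ).toReal ^ 2 := by
  have := integral_norm_eq_lintegral_enorm (hf.1.norm.pow 2)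
  simp only [norm_pow, norm_norm, enorm_pow, enorm_norm, Pi.pow_apply] at this
  rw [this, lintegral_enorm_sq_eq, ENNReal.toReal_pow]

lemma frontier_subset_frontier_annular {N : ℕ} {Ωin Ωout : Set (Euc N)} (hΩ : IsOpen Ωout)
    (hsub : closure Ωin ⊆ Ωout) : frontier Ωout ⊆ frontier (annular Ωin Ωout) := by
  intro x hx
  rw [hΩ.frontier_eq] at hx
  rw [annular, (hΩ.sdiff isClosed_closure).frontier_eq]
  refine ⟨?_, fun h ↦ hx.2 h.1⟩
  have h1 : x ∈ (closure Ωin)ᶜ := fun h ↦ hx.2 (hsub h)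
  rw [sdiff_eq, inter_comm]
  exact isClosed_closure.isOpen_compl.inter_closure ⟨h1, hx.1⟩

/-- The Poincaré inequality with boundary term passes from smooth functions to the functions of
`H¹` that have a trace. -/
lemma integral_sq_le_of_isTrace {n : ℕ} {L : Fin (n + 1) → ℝ} (hL : ∀ i, 0 < L i) (hL0 : L 0 = 1)
    {α : ℝ} (hα : 0 < α) (hsub : Metric.closedBall 0 α ⊆ openBox L) {v : Euc (n + 1) → ℝ}
    {g : Euc (n + 1) → Euc (n + 1)} {T : Euc (n + 1) → ℝ}
    (hv : MemH1 (annular (originBall (n + 1) α) (openBox L)) v g)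
    (hT : IsTrace (annular (originBall (n + 1) α) (openBox L)) v g T) :
    ∫ x in annular (originBall (n + 1) α) (openBox L), v x ^ 2 ≤
      8 * (∫ x in frontier (openBox L), T x ^ 2 ∂(surf (n + 1))) +
        4 * ∫ x in annular (originBall (n + 1) α) (openBox L), ‖g x‖ ^ 2 := by
  have hcl : closure (originBall (n + 1) α) = Metric.closedBall 0 α := closure_ball _ hα.ne'
  obtain ⟨hTm, φ, hφ, h1, h2, h3⟩ := hT
  have hfr := frontier_subset_frontier_annular (isOpen_openBox L) (hcl.trans_subset hsub)
  set Ω := annular (originBall (n + 1) α) (openBox L) with hΩ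
  have hΩ' : Ω = openBox L \ Metric.closedBall 0 α := by rw [hΩ, annular, hcl]
  set μ := (volume : Measure (Euc (n + 1))).restrict Ω with hμ
  set σ := (surf (n + 1)).restrict (frontier (openBox L)) with hσ
  have hσle : σ ≤ (surf (n + 1)).restrict (frontier Ω) := Measure.restrict_mono hfr le_rfl
  have hTσ : MemLp T 2 σ := hTm.mono_measure hσle
  have h3' : Tendsto (fun m ↦ eLpNorm (fun x ↦ φ m x - T x) 2 σ) atTop (𝓝 0) :=
    tendsto_of_tendsto_of_tendsto_of_le_of_le tendsto_const_nhds h3 (fun _ ↦ zero_le)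
      fun m ↦ eLpNorm_mono_measure _ hσle
  have t1 := tendsto_eLpNorm_of_tendsto_sub
    (fun m ↦ (hφ m).continuous.aestronglyMeasurable) hv.memLp h1
  have t2 := tendsto_eLpNorm_of_tendsto_sub
    (fun m ↦ (continuous_gradient (hφ m)).aestronglyMeasurable) hv.memLp_grad h2
  have t3 := tendsto_eLpNorm_of_tendsto_sub
    (fun m ↦ (hφ m).continuous.aestronglyMeasurable) hTσ h3'
  have key : eLpNorm v 2 μ ^ 2 ≤ 8 * eLpNorm T 2 σ ^ 2 + 4 * eLpNorm g 2 μ ^ 2 := by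
    refine le_of_tendsto_of_tendsto' (ENNReal.Tendsto.pow t1)
      ((ENNReal.Tendsto.const_mul (ENNReal.Tendsto.pow t3) (Or.inr (by simp))).add
        (ENNReal.Tendsto.const_mul (ENNReal.Tendsto.pow t2) (Or.inr (by simp)))) fun m ↦ ?_
    have := lintegral_sq_le_of_contDiff hL hL0 α (hφ m)
    rw [← hΩ', lintegral_enorm_sq_eq, lintegral_enorm_sq_eq, lintegral_enorm_sq_eq] at this
    exact this
  have e1 := integral_norm_sq_eq hv.memLp
  have e2 := integral_norm_sq_eq hv.memLp_grad
  have e3 := integral_norm_sq_eq hTσ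
  simp only [Real.norm_eq_abs, sq_abs] at e1 e3
  rw [e1, e2, e3]
  have hTt := hTσ.eLpNorm_ne_top
  have hgt := hv.memLp_grad.eLpNorm_ne_top
  have := ENNReal.toReal_mono (by finiteness) key
  rw [ENNReal.toReal_add (by finiteness) (by finiteness)] at this
  simpa [ENNReal.toReal_mul, ENNReal.toReal_pow] using this

/-- On a box of half-length `1` in the first direction, minus a centered ball, the first eigenvalue
is bounded below independently of the size of the box, as soon as the outer Robin parameter is
at least `1`. -/
lemma le_firstEigenvalue_openBox {n : ℕ} {L : Fin (n + 1) → ℝ} (hL : ∀ i, 0 < L i) (hL0 : L 0 = 1)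
    {α : ℝ} (hα : 0 < α) (hsub : Metric.closedBall 0 α ⊆ openBox L)
    (hne : (annular (originBall (n + 1) α) (openBox L)).Nonempty)
    (hin hout : ℝ≥0∞) (hh : 1 ≤ hout) :
    1 / 8 ≤ firstEigenvalue (originBall (n + 1) α) (openBox L) hin hout := by
  refine le_csInf (rayleighQuotients_nonempty hin hout (isOpen_openBox L) hne) ?_
  rintro q ⟨v, g, T, hv, hT, hv0, -, hTout, rfl⟩
  have h := integral_sq_le_of_isTrace hL hL0 hα hsub hv hT
  have hpos : 0 < ∫ x in annular (originBall (n + 1) α) (openBox L), v x ^ 2 := by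
    refine lt_of_le_of_ne (integral_nonneg fun x ↦ sq_nonneg _) fun h0 ↦ hv0 ?_
    have := (integral_eq_zero_iff_of_nonneg (fun x ↦ sq_nonneg (v x)) hv.memLp.integrable_sq).1
      h0.symm
    filter_upwards [this] with x hx
    simpa using hx
  rw [le_div_iff₀ hpos, robinEnergy]
  have hi : 0 ≤ hin.toReal * ∫ x in frontier (originBall (n + 1) α), T x ^ 2 ∂(surf (n + 1)) :=
    mul_nonneg ENNReal.toReal_nonneg (integral_nonneg fun x ↦ sq_nonneg _)
  have ho0 : 0 ≤ ∫ x in frontier (openBox L), T x ^ 2 ∂(surf (n + 1)) :=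
    integral_nonneg fun x ↦ sq_nonneg _
  have hg0 : 0 ≤ ∫ x in annular (originBall (n + 1) α) (openBox L), ‖g x‖ ^ 2 :=
    integral_nonneg fun x ↦ sq_nonneg _
  have ho : ∫ x in frontier (openBox L), T x ^ 2 ∂(surf (n + 1)) ≤
      hout.toReal * ∫ x in frontier (openBox L), T x ^ 2 ∂(surf (n + 1)) := by
    -- For `hout = ⊤` the factor `hout.toReal` is `0`, but then `T` vanishes.
    by_cases htop : hout = ⊤
    · rw [integral_eq_zero_of_ae, mul_zero]
      filter_upwards [hTout htop] with x hx
      simp [hx]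
    · have : 1 ≤ hout.toReal := by simpa using ENNReal.toReal_mono htop hh
      nlinarith
  linarith

/-! ### The ball with the perimeter of the box -/

/-- The radius of the ball with the same perimeter as the box `R_k`. -/
def boxRadius (n : ℕ) (k : ℝ) : ℝ :=
  ((perimeter (box (n + 1) k)).toReal / (surf (n + 1) (Metric.sphere 0 1)).toReal) ^ (n⁻¹ : ℝ)

lemma boxRadius_pos {n : ℕ} {k : ℝ} (hk : 0 < k) : 0 < boxRadius n k := by
  refine Real.rpow_pos_of_pos (div_pos ?_ ?_) _
  · refine ENNReal.toReal_pos (ne_of_gt ?_) (perimeter_box_lt_top hk).ne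
    exact (ENNReal.ofReal_pos.2 (by positivity)).trans_le (le_perimeter_box hk)
  · exact ENNReal.toReal_pos (surf_sphere_pos n).ne' (surf_sphere_lt_top n).ne

lemma perimeter_originBall_eq_iff {n : ℕ} (hn : 1 ≤ n) {k r : ℝ} (hk : 0 < k) (hr : 0 < r) :
    perimeter (originBall (n + 1) r) = perimeter (box (n + 1) k) ↔ r = boxRadius n k := by
  have hS := ENNReal.toReal_pos (surf_sphere_pos n).ne' (surf_sphere_lt_top n).ne
  have hn0 : n ≠ 0 := by omega
  rw [perimeter_originBall hr, ← ENNReal.toReal_eq_toReal_iff'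
    (ENNReal.mul_ne_top ENNReal.ofReal_ne_top (surf_sphere_lt_top n).ne)
    (perimeter_box_lt_top hk).ne, ENNReal.toReal_mul, ENNReal.toReal_ofReal (by positivity),
    ← eq_div_iff hS.ne', boxRadius]
  have hq : 0 ≤ (perimeter (box (n + 1) k)).toReal /
      (surf (n + 1) (Metric.sphere 0 1)).toReal := by positivity
  constructor
  · intro h
    rw [← h, Real.pow_rpow_inv_natCast hr.le hn0]
  · intro h
    rw [h, Real.rpow_inv_natCast_pow hq hn0]

lemma perimeter_originBall_boxRadius {n : ℕ} (hn : 1 ≤ n) {k : ℝ} (hk : 0 < k) :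
    perimeter (originBall (n + 1) (boxRadius n k)) = perimeter (box (n + 1) k) :=
  (perimeter_originBall_eq_iff hn hk (boxRadius_pos hk)).2 rfl

lemma lt_boxRadius_pow {n : ℕ} (hn : 1 ≤ n) {k : ℝ} (hk : 1 < k) :
    k < boxRadius n k ^ (n + 1) := by
  have hβ := boxRadius_pos (n := n) (zero_lt_one.trans hk)
  have h := volume_box_lt_of_perimeter_eq hn hk hβ
    (perimeter_originBall_boxRadius hn (zero_lt_one.trans hk))
  have h2 : boxRadius n k ^ (n + 1) * volume.real (Metric.ball (0 : Euc (n + 1)) 1) ≤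
      boxRadius n k ^ (n + 1) * 2 ^ (n + 1) := by
    gcongr
    exact volume_ball_le n
  have h3 : 2 ^ (n + 1) * k < 2 ^ (n + 1) * boxRadius n k ^ (n + 1) := by linarith
  exact lt_of_mul_lt_mul_left h3 (by positivity)

lemma one_lt_boxRadius {n : ℕ} (hn : 1 ≤ n) {k : ℝ} (hk : 1 < k) : 1 < boxRadius n k :=
  (one_lt_pow_iff_of_nonneg (boxRadius_pos (zero_lt_one.trans hk)).le (Nat.succ_ne_zero n)).1
    (hk.trans (lt_boxRadius_pow hn hk))

lemma volume_box_lt_volume_originBall {n : ℕ} (hn : 1 ≤ n) {k : ℝ} (hk : 1 < k) :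
    volume (box (n + 1) k) < volume (originBall (n + 1) (boxRadius n k)) := by
  have hβ := boxRadius_pos (n := n) (zero_lt_one.trans hk)
  have h := volume_box_lt_of_perimeter_eq hn hk hβ
    (perimeter_originBall_boxRadius hn (zero_lt_one.trans hk))
  rw [volume_box (zero_lt_one.trans hk), originBall, Measure.addHaar_ball_of_pos _ _ hβ,
    finrank_euclideanSpace_fin, ← ENNReal.ofReal_toReal measure_ball_lt_top.ne,
    ← ENNReal.ofReal_mul (by positivity)]
  exact (ENNReal.ofReal_lt_ofReal_iff_of_nonneg (by positivity)).2 h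

lemma closure_originBall_subset_box {n : ℕ} {k α : ℝ} (hk : 1 ≤ k) (hα0 : 0 < α) (hα1 : α < 1) :
    closure (originBall (n + 1) α) ⊆ box (n + 1) k := by
  rw [originBall, closure_ball _ hα0.ne']
  exact (Metric.closedBall_subset_ball hα1).trans (ball_subset_box hk)

lemma volume_annular_lt {N : ℕ} {Ωin Ωout Ωout' : Set (Euc N)} (h : closure Ωin ⊆ Ωout)
    (h' : closure Ωin ⊆ Ωout') (hfin : volume Ωout ≠ ⊤) (hlt : volume Ωout < volume Ωout') :
    volume (annular Ωin Ωout) < volume (annular Ωin Ωout') := by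
  have hfin' : volume (closure Ωin) ≠ ⊤ := measure_ne_top_of_subset h hfin
  rw [annular, annular, measure_sdiff h isClosed_closure.nullMeasurableSet hfin',
    measure_sdiff h' isClosed_closure.nullMeasurableSet hfin']
  exact (ENNReal.cancel_of_ne hfin').tsub_lt_tsub_right_of_le (measure_mono h) hlt

lemma shellConstraints {n : ℕ} (hn : 1 ≤ n) {k α : ℝ} (hk : 1 < k) (hα0 : 0 < α) (hα1 : α < 1) :
    ShellConstraints α (boxRadius n k) (originBall (n + 1) α) (box (n + 1) k) where
  pos := hα0
  lt := hα1.trans (one_lt_boxRadius hn hk)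
  closure_subset := closure_originBall_subset_box hk.le hα0 hα1
  convex_in := convex_ball _ _
  convex_out := by
    rw [box_eq_openBox]
    exact convex_openBox _
  quermass_eq := rfl
  perimeter_eq := perimeter_originBall_boxRadius hn (zero_lt_one.trans hk)

/-- For `k` large the shell contains large balls, so its first eigenvalue is small. -/
lemma exists_firstEigenvalue_shell_lt {n : ℕ} (hn : 1 ≤ n) {α ε : ℝ} (hα0 : 0 < α) (hα1 : α < 1)
    (hε : 0 < ε) : ∃ K : ℝ, 1 < K ∧ ∀ k, K ≤ k → ∀ hin hout : ℝ≥0∞,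
      firstEigenvalue (originBall (n + 1) α) (originBall (n + 1) (boxRadius n k)) hin hout < ε := by
  obtain ⟨ρ, hρ, h⟩ := exists_firstEigenvalue_lt (n + 1) hε
  have hM : 1 < (2 * ρ + 1) ^ (n + 1) := one_lt_pow₀ (by linarith) (Nat.succ_ne_zero n)
  -- The closed ball of radius `ρ` centered at distance `ρ + 1` from the origin avoids `B_1` and
  -- lies in the ball of radius `2 * ρ + 1 < β_k`.
  refine ⟨(2 * ρ + 1) ^ (n + 1), hM, fun k hk hin hout ↦ ?_⟩
  refine h (EuclideanSpace.single 0 (ρ + 1)) _ _ hin hout Metric.isOpen_ball fun x hx ↦ ?_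
  have hlt : 2 * ρ + 1 < boxRadius n k :=
    lt_of_pow_lt_pow_left₀ _ (boxRadius_pos (by linarith)).le
      (hk.trans_lt (lt_boxRadius_pow hn (hM.trans_le hk)))
  have hc : ‖(EuclideanSpace.single 0 (ρ + 1) : Euc (n + 1))‖ = ρ + 1 := by
    rw [PiLp.norm_single, Real.norm_of_nonneg (by linarith)]
  rw [mem_closedBall_iff_norm] at hx
  have h1 := norm_sub_norm_le (EuclideanSpace.single 0 (ρ + 1) : Euc (n + 1)) x
  have h2 := norm_le_norm_add_norm_sub' x (EuclideanSpace.single 0 (ρ + 1) : Euc (n + 1))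
  rw [norm_sub_rev] at h1
  rw [annular, originBall, originBall, closure_ball _ hα0.ne']
  refine ⟨?_, fun h3 ↦ ?_⟩
  · rw [mem_ball_zero_iff]
    linarith
  · rw [mem_closedBall_zero_iff] at h3
    linarith

lemma le_firstEigenvalue_box {n : ℕ} (hn : 1 ≤ n) {k α : ℝ} (hk : 1 ≤ k) (hα0 : 0 < α)
    (hα1 : α < 1) (hin hout : ℝ≥0∞) (hh : 1 ≤ hout) :
    1 / 8 ≤ firstEigenvalue (originBall (n + 1) α) (box (n + 1) k) hin hout := by
  have hsub := closure_originBall_subset_box (n := n) hk hα0 hα1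
  have hne : (annular (originBall (n + 1) α) (box (n + 1) k)).Nonempty := by
    have hc : ‖(EuclideanSpace.single 0 ((α + 1) / 2) : Euc (n + 1))‖ = (α + 1) / 2 := by
      rw [PiLp.norm_single, Real.norm_of_nonneg (by linarith)]
    refine ⟨EuclideanSpace.single 0 ((α + 1) / 2), ball_subset_box hk ?_, ?_⟩
    · rw [mem_ball_zero_iff]
      linarith
    · rw [originBall, closure_ball _ hα0.ne', mem_closedBall_zero_iff]
      linarith
  have hL0 : halfLength n k 0 = 1 := if_neg (by simp; omega)
  rw [originBall, closure_ball _ hα0.ne'] at hsub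
  rw [box_eq_openBox] at hsub hne ⊢
  exact le_firstEigenvalue_openBox (halfLength_pos (by linarith)) hL0 hα0 hsub hne hin hout hh

end HerschWeinberger

end

theorem mainTheorem7 (N : ℕ) (hN : 2 ≤ N) (α : ℝ) (hα0 : 0 < α) (hα1 : α < 1) :
    ∃ β : ℝ → ℝ,
      -- for every `k > 1`, `β k` is the unique positive radius with `|∂B_{β k}| = |∂R_k|`
      (∀ k : ℝ, 1 < k → 0 < β k ∧ ∀ r : ℝ, 0 < r →
        (HerschWeinberger.perimeter (HerschWeinberger.originBall N r) =
          HerschWeinberger.perimeter (HerschWeinberger.box N k) ↔ r = β k)) ∧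
      -- for every `k > 1`, the constraints hold, but the volume is too small
      (∀ k : ℝ, 1 < k →
        HerschWeinberger.ShellConstraints α (β k)
          (HerschWeinberger.originBall N α) (HerschWeinberger.box N k) ∧
        volume (HerschWeinberger.annular (HerschWeinberger.originBall N α)
            (HerschWeinberger.box N k)) <
          volume (HerschWeinberger.annular (HerschWeinberger.originBall N α)
            (HerschWeinberger.originBall N (β k)))) ∧
      -- for every large `k`, the eigenvalue inequality is reversed
      (∃ (K : ℝ) (H : ℝ≥0), 1 < K ∧ ∀ k : ℝ, K ≤ k →
        -- Dirichlet conditions on both boundary components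
        HerschWeinberger.firstEigenvalue (HerschWeinberger.originBall N α)
            (HerschWeinberger.originBall N (β k)) ⊤ ⊤ <
          HerschWeinberger.firstEigenvalue (HerschWeinberger.originBall N α)
            (HerschWeinberger.box N k) ⊤ ⊤ ∧
        -- all sufficiently large Robin parameters
        ∀ hin hout : ℝ≥0∞, (H : ℝ≥0∞) ≤ hin → (H : ℝ≥0∞) ≤ hout →
          HerschWeinberger.firstEigenvalue (HerschWeinberger.originBall N α)
              (HerschWeinberger.originBall N (β k)) hin hout <
            HerschWeinberger.firstEigenvalue (HerschWeinberger.originBall N α)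
              (HerschWeinberger.box N k) hin hout) := by
  obtain ⟨n, rfl⟩ : ∃ n, N = n + 1 := ⟨N - 1, by omega⟩
  have hn : 1 ≤ n := by omega
  refine ⟨HerschWeinberger.boxRadius n, fun k hk ↦ ?_, fun k hk ↦ ?_, ?_⟩
  · have hk0 : 0 < k := zero_lt_one.trans hk
    exact ⟨HerschWeinberger.boxRadius_pos hk0, fun r hr ↦
      HerschWeinberger.perimeter_originBall_eq_iff hn hk0 hr⟩
  · have hlt := HerschWeinberger.volume_box_lt_volume_originBall hn hk
    refine ⟨HerschWeinberger.shellConstraints hn hk hα0 hα1, HerschWeinberger.volume_annular_lt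
      (HerschWeinberger.closure_originBall_subset_box hk.le hα0 hα1) ?_ hlt.ne_top hlt⟩
    rw [HerschWeinberger.originBall, HerschWeinberger.originBall, closure_ball _ hα0.ne']
    exact Metric.closedBall_subset_ball (hα1.trans (HerschWeinberger.one_lt_boxRadius hn hk))
  · obtain ⟨K, hK, h⟩ := HerschWeinberger.exists_firstEigenvalue_shell_lt hn hα0 hα1
      (ε := 1 / 8) (by norm_num)
    refine ⟨K, 1, hK, fun k hk ↦ ⟨?_, fun hin hout _ hh ↦ ?_⟩⟩
    · exact (h k hk ⊤ ⊤).trans_le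
        (HerschWeinberger.le_firstEigenvalue_box hn (hK.le.trans hk) hα0 hα1 ⊤ ⊤ le_top)
    · exact (h k hk hin hout).trans_le
        (HerschWeinberger.le_firstEigenvalue_box hn (hK.le.trans hk) hα0 hα1 hin hout
          (by simpa using hh))
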